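/- Let $\nu_*$ be a non-negative measure on $[-1,1]$ with $\int_{[-1,1]}(1-\xi)\,\nu_*(d\xi)<\infty$, and for measurable $f:[-1,1]\to[0,1]$ with $\int(1-f)\,d\nu_*<\infty$ put $$G[f]=\frac{1}{1+\int_{[-1,1]}(1-f(\xi))\,\nu_*(d\xi)} .$$ Let $Y$ and $Y_{1/2}$ be random variables in $[-1,1]$ distributed as the product $\prod_j\xi_j$ of the points of a point process on $[-1,1]$ whose probability generating functional $f\mapsto\mathbb{E}\big[\prod_j f(\xi_j)\big]$ is $G[f]$, respectively $G[f]^{1/2}$. Assume that $\mathbb{E}\big[(1-Y)^{-1/2}\big]<\infty$ (the integrand being $+\infty$ where $Y=1$). Let $H_k$ be the Hermite polynomials, $\sum_{k\ge 0} \frac{w^k}{k!}H_k(t)=e^{wt-w^2/2}$, let $Q_k(v;N,\tfrac12)$ be the Krawtchouk polynomials, $\sum_{k=0}^N\binom Nk Q_k(v;N,\tfrac12)z^k=(1-z)^v(1+z)^{N-v}$, and let $\mathfrak{n}(t,s;\rho)$ be the standard bivariate normal density with correlation $\rho$. (i) Let $(\zeta_k)_{k\ge 0}$ be i.i.d. $N(0,1)$.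 For every $t\in\mathbb{R}$ the series $$\varkappa_t=\frac{1}{\sqrt{2\pi}}e^{-t^2/2}\sum_{k=0}^\infty\mathbb{E}\big[Y_{1/2}^k\big]\frac{1}{\sqrt{k!}}H_k(t)\,\zeta_k$$ converges almost surely and in $L^2$, and $(\varkappa_t)_{t\in\mathbb{R}}$ is a centered Gaussian process. (ii) Almost surely $|Y|<1$, and for all $s,t\in\mathbb{R}$ $$\mathrm{Cov}(\varkappa_t,\varkappa_s)=\frac{1}{2\pi}e^{-(t^2+s^2)/2}\Big\{1+\sum_{k=1}^\infty\mathbb{E}\big[Y^k\big]\frac{1}{k!}H_k(t)H_k(s)\Big\}=\mathbb{E}\big[\mathfrak{n}(t,s;Y)\big],$$ where the series converges and the expectation is finite. (iii) For each $N$ let $(g^{(N)}_y)_{y\in\{0,1\}^N}$ be a random field whose level set sums $\vartheta^{(N)}_v=\sum_{\|y\|=v}g^{(N)}_y$ (with $\|y\|$ the number of ones in $y$) satisfy, for $v=0,\dots,N$, $$\vartheta^{(N)}_v=\binom Nv\frac{1}{2^{N/2}}\sum_{k=0}^N\mathbb{E}\big[Y_{1/2}^k\big]\sqrt{\tbinom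 Nk}\,Q_k(v;N,\tfrac12)\,\zeta^{(N)}_k\quad\text{a.s.,}$$ with $\zeta^{(N)}_0,\dots,\zeta^{(N)}_N$ i.i.d. $N(0,1)$. Then, as $N\to\infty$, the finite-dimensional distributions of $$\frac12\sqrt{\frac{N}{2^N}}\;\Big(\vartheta^{(N)}_{\lfloor \frac N2+\frac{\sqrt N}{2}t\rfloor}\Big)_{|t|<\sqrt N}$$ converge weakly to those of $(\varkappa_t)_{t\in\mathbb{R}}$. -/

import Mathlib

open MeasureTheory ProbabilityTheory Filter Topology

noncomputable section

namespace HypercubeField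

/-- The interval `[-1, 1]`. -/
abbrev SpinInterval : Type := Set.Icc (-1 : ℝ) 1

/-- A point process on `[-1, 1]` with countably many points, listed with multiplicity: the points
of the realization `ω` are `pt j ω` for `j < count ω`. -/
structure RandomPoints (Ω : Type*) [MeasurableSpace Ω] where
  /-- the number of points, possibly infinite -/
  count : Ω → ℕ∞
  /-- the enumeration of the points -/
  pt : ℕ → Ω → SpinInterval
  measurable_count : Measurable count
  measurable_pt : ∀ j, Measurable (pt j)

/-- `f` at the `j`-th point of the process, and `1` if there is no `j`-th point. -/
def RandomPoints.factor {Ω : Type*} [MeasurableSpace Ω] (X : RandomPoints Ω)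
    (f : SpinInterval → ℝ) (j : ℕ) (ω : Ω) : ℝ :=
  if (j : ℕ∞) < X.count ω then f (X.pt j ω) else 1

/-- The probability generating functional `f ↦ E[∏_j f(ξ_j)]`. For `0 ≤ f ≤ 1` the product always
converges, unconditionally. -/
def RandomPoints.pgfl {Ω : Type*} [MeasurableSpace Ω] (X : RandomPoints Ω) (Q : Measure Ω)
    (f : SpinInterval → ℝ) : ℝ :=
  ∫ ω, ∏' j, X.factor f j ω ∂Q

/-- The functional `G[f] = 1 / (1 + ∫ (1 - f(ξ)) ν(dξ))`. -/
def genFunctional (ν : Measure SpinInterval) (f : SpinInterval → ℝ) : ℝ :=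
  1 / (1 + ∫ ξ, (1 - f ξ) ∂ν)

/-- `X` has probability generating functional `G[f] ^ φ`, on the measurable `f` with `0 ≤ f ≤ 1`
for which the integral in `G[f]` is finite. -/
def RandomPoints.HasPgfl {Ω : Type*} [MeasurableSpace Ω] (X : RandomPoints Ω) (Q : Measure Ω)
    (ν : Measure SpinInterval) (φ : ℝ) : Prop :=
  ∀ f : SpinInterval → ℝ, Measurable f → (∀ ξ, 0 ≤ f ξ ∧ f ξ ≤ 1) →
    Integrable (fun ξ => 1 - f ξ) ν → X.pgfl Q f = genFunctional ν f ^ φ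

/-- `Y` is the product of the points of a point process with probability generating functional
`G[f] ^ φ`. -/
def IsProductOfPoints {Ω : Type*} [MeasurableSpace Ω] (Q : Measure Ω)
    (ν : Measure SpinInterval) (φ : ℝ) (Y : Ω → ℝ) : Prop :=
  ∃ X : RandomPoints Ω, X.HasPgfl Q ν φ ∧
    ∀ᵐ ω ∂Q, HasProd (fun j => X.factor (fun ξ => (ξ : ℝ)) j ω) (Y ω)

/-- The `k`-th moment `E[Y ^ k]`. -/
def rawMoment {Ω : Type*} [MeasurableSpace Ω] (Q : Measure Ω) (Y : Ω → ℝ) (k : ℕ) : ℝ :=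
  ∫ ω, Y ω ^ k ∂Q

/-- The hypercube `{0, 1} ^ N`. -/
abbrev Cube (N : ℕ) : Type := Fin N → ZMod 2

/-- The level set sum `∑_{‖y‖ = v} g_y`, with `‖y‖` the number of entries of `y` equal to `1`. -/
def levelSum {N : ℕ} {Ω : Type*} (g : Cube N → Ω → ℝ) (v : ℕ) (ω : Ω) : ℝ :=
  ∑ y : Cube N with hammingNorm y = v, g y ω

/-- The symmetric Krawtchouk polynomial `Q_k(v; N, 1/2)` scaled to be `1` at `v = 0`, at the
arguments `0 ≤ k, v ≤ N`: `N.choose k * Q_k(v; N, 1/2)` is the coefficient of `z ^ k` in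
`(1 - z) ^ v * (1 + z) ^ (N - v)`. -/
def krawtchouk (N k v : ℕ) : ℝ :=
  ((1 - Polynomial.X : Polynomial ℝ) ^ v * (1 + Polynomial.X) ^ (N - v)).coeff k /
    (N.choose k : ℝ)

/-- The Hermite-Chebyshev polynomial `H_k`, orthogonal for the standard normal law and monic. -/
def hermiteH (k : ℕ) (t : ℝ) : ℝ := Polynomial.aeval t (Polynomial.hermite k)

/-- The sum of the terms `k < n` of the series
`(2π)^{-1/2} e^{-t²/2} ∑_k m_k (k!)^{-1/2} H_k(t) ζ_k`. -/
def kappaPartial {Ω : Type*} (m : ℕ → ℝ) (ζ : ℕ → Ω → ℝ) (n : ℕ) (t : ℝ) (ω : Ω) : ℝ :=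
  1 / √(2 * Real.pi) * Real.exp (-t ^ 2 / 2) *
    ∑ k ∈ Finset.range n, m k * (1 / √(k.factorial : ℝ)) * hermiteH k t * ζ k ω

/-- The sum of that series, as the pointwise limit of its partial sums. -/
def kappa {Ω : Type*} (m : ℕ → ℝ) (ζ : ℕ → Ω → ℝ) (t : ℝ) (ω : Ω) : ℝ :=
  limUnder atTop (fun n => kappaPartial m ζ n t ω)

/-- The standard bivariate normal density at `(t, s)`, with correlation `ρ` in `(-1, 1)`. -/
def bivariateNormalDensity (t s ρ : ℝ) : ℝ :=
  1 / (2 * Real.pi * √(1 - ρ ^ 2)) *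
    Real.exp (-(t ^ 2 - 2 * ρ * t * s + s ^ 2) / (2 * (1 - ρ ^ 2)))

end HypercubeField

end

/-!
The moments of `Y_{1/2}` and `Y` are related by `E[Y_{1/2}^k]² = E[Y^k]`. For even `k` this is the
generating functional at `f(ξ) = ξ^k`. For odd `k` the function `ξ^k` takes negative values, and the
functional is evaluated at `|ξ|^k` with an extra weight `z` in `[0, 1)` at the negative points
(`signWeight`). As a function of `z` the result is a power series whose coefficients sort the
realizations by the number of negative points. The identity of the two power series on `[0, 1)`
forces the identity of the coefficients, hence of the values at `z = -1`, which are the odd moments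
(`sq_rawMoment_half`).

So all moments of `Y` are nonnegative. Since `Y = 1` has probability zero, the odd moments exclude an
atom at `-1`, and `x^{-1/2}` being a mixture of exponentials they give
`E(1 + Y)^{-1/2} ≤ E(1 - Y)^{-1/2}`; hence `E(1 - Y²)^{-1/2}` is finite
(`integrable_inv_sqrt_one_sub_sq`). By Mehler's formula (`hasSum_mehler`, obtained by expanding a
bilinear exponential in a Gaussian double integral) the coefficients of the limit series are square
summable with `E(1 - Y²)^{-1/2}` as a bound. Almost sure and mean square convergence, Gaussianity and
the covariance follow from the theory of square summable series of independent normal variables, and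
the expectation of Mehler's formula gives the mixture of bivariate normal densities.

For the convergence of the level set sums, only joint laws matter, so the Gaussian vector of the
`N`-th field may be replaced by the variables `(-1)^k ζ_k` of the limit series. The rescaled level set
sum and the limit are then two series in the same variables, and it remains to show that their
coefficients approach each other in `ℓ²`. Each coefficient converges (`tendsto_levelCoeff`): the
binomial factor by the local de Moivre-Laplace theorem, the Krawtchouk polynomials because their
three-term recurrence tends to that of the Hermite polynomials, with the sign `(-1)^k`. The passage to
`ℓ²` is by dominated convergence. Self-duality of the Krawtchouk polynomials turns the sum
`∑_k ρ^k (coefficient)²` into a single coefficient of a product of linear polynomials, and Cauchy's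
formula on the unit circle bounds it by `(1 - ρ²)^{-1/2}`, uniformly in `N` and in the level
(`sum_pow_mul_sq_levelCoeff_le`); at `ρ = |Y|` this has a finite expectation.
-/

noncomputable section

namespace HypercubeField

/-! ### Series of independent Gaussian variables -/

section GaussianSeries

variable {Ω : Type*} {ζ : ℕ → Ω → ℝ}

/-- The partial sum `∑_{k < n} a_k ζ_k`. -/
def partialSum (ζ : ℕ → Ω → ℝ) (a : ℕ → ℝ) (n : ℕ) (ω : Ω) : ℝ :=
  ∑ k ∈ Finset.range n, a k * ζ k ω

lemma partialSum_sub (a b : ℕ → ℝ) (n : ℕ) (ω : Ω) :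
    partialSum ζ (fun k => a k - b k) n ω = partialSum ζ a n ω - partialSum ζ b n ω := by
  simp [partialSum, sub_mul]

lemma partialSum_add (a b : ℕ → ℝ) (n : ℕ) (ω : Ω) :
    partialSum ζ (fun k => a k + b k) n ω = partialSum ζ a n ω + partialSum ζ b n ω := by
  simp [partialSum, add_mul, Finset.sum_add_distrib]

variable [MeasurableSpace Ω] {P : Measure Ω}

lemma aemeasurable_partialSum (hlaw : ∀ k, HasLaw (ζ k) (gaussianReal 0 1) P) (a : ℕ → ℝ) (n : ℕ) :
    AEMeasurable (partialSum ζ a n) P := by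
  unfold partialSum
  exact Finset.aemeasurable_fun_sum _ fun k _ => (hlaw k).aemeasurable.const_mul _

lemma aemeasurable_of_ae_tendsto_partialSum {a : ℕ → ℝ} {S : Ω → ℝ}
    (hlaw : ∀ k, HasLaw (ζ k) (gaussianReal 0 1) P)
    (hS : ∀ᵐ ω ∂P, Tendsto (fun n => partialSum ζ a n ω) atTop (𝓝 (S ω))) :
    AEMeasurable S P :=
  aemeasurable_of_tendsto_metrizable_ae atTop (aemeasurable_partialSum hlaw a) hS

variable [IsProbabilityMeasure P]

lemma hasLaw_partialSum (hlaw : ∀ k, HasLaw (ζ k) (gaussianReal 0 1) P) (hind : iIndepFun ζ P)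
    (a : ℕ → ℝ) (n : ℕ) :
    HasLaw (partialSum ζ a n)
      (gaussianReal 0 (∑ k ∈ Finset.range n, (a k ^ 2).toNNReal)) P := by
  have hmem : ∀ k, MemLp (fun ω => a k * ζ k ω) 2 P := fun k =>
    ((hlaw k).hasGaussianLaw.memLp_two).const_mul (a k)
  have hg : HasGaussianLaw (partialSum ζ a n) P := by
    have h1 : HasGaussianLaw (fun ω => fun k : Fin n => ζ k ω) P :=
      iIndepFun.hasGaussianLaw (fun k => (hlaw k).hasGaussianLaw)
        (hind.precomp (g := fun k : Fin n => (k : ℕ)) Fin.val_injective)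
    have h2 := h1.map_fun (∑ k : Fin n, (a k) • ContinuousLinearMap.proj (R := ℝ) k)
    refine h2.congr (ae_of_all _ fun ω => ?_)
    simp [partialSum, Finset.sum_range]
  refine ⟨hg.aemeasurable, ?_⟩
  rw [hg.map_eq_gaussianReal]
  have hmean : ∫ ω, partialSum ζ a n ω ∂P = 0 := by
    unfold partialSum
    rw [integral_finsetSum _ fun k _ => (hmem k).integrable (by norm_num)]
    refine Finset.sum_eq_zero fun k _ => ?_
    rw [integral_const_mul, (hlaw k).integral_eq, integral_id_gaussianReal, mul_zero]
  have hvar : Var[partialSum ζ a n; P] = ∑ k ∈ Finset.range n, a k ^ 2 := by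
    have := IndepFun.variance_sum (μ := P) (X := fun k ω => a k * ζ k ω) (s := Finset.range n)
      (fun k _ => hmem k) (fun i _ j _ hij =>
        (hind.indepFun hij).comp (φ := fun x => a i * x) (ψ := fun x => a j * x)
          (by fun_prop) (by fun_prop))
    have h3 : partialSum ζ a n = ∑ k ∈ Finset.range n, fun ω => a k * ζ k ω := by
      ext ω; simp [partialSum]
    rw [h3, this]
    refine Finset.sum_congr rfl fun k _ => ?_
    rw [variance_const_mul, (hlaw k).variance_eq, variance_id_gaussianReal]
    simp
  rw [hmean, hvar]
  congr 1
  rw [Real.toNNReal_sum_of_nonneg fun k _ => sq_nonneg _]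

lemma eLpNorm_partialSum_le (hlaw : ∀ k, HasLaw (ζ k) (gaussianReal 0 1) P) (hind : iIndepFun ζ P)
    {a : ℕ → ℝ} (ha : Summable fun k => a k ^ 2) (n : ℕ) :
    eLpNorm (partialSum ζ a n) 2 P ≤ ENNReal.ofReal √(∑' k, a k ^ 2) := by
  have hl := hasLaw_partialSum hlaw hind a n
  have hm : MemLp (partialSum ζ a n) 2 P := hl.hasGaussianLaw.memLp_two
  rw [hm.eLpNorm_eq_integral_rpow_norm (by norm_num) (by norm_num)]
  apply ENNReal.ofReal_le_ofReal
  rw [Real.sqrt_eq_rpow]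
  simp only [ENNReal.toReal_ofNat, Real.rpow_ofNat, Real.norm_eq_abs, sq_abs]
  rw [one_div]
  refine Real.rpow_le_rpow (by positivity) ?_ (by norm_num)
  have hv : Var[partialSum ζ a n; P] = ∑ k ∈ Finset.range n, a k ^ 2 := by
    rw [hl.variance_eq, variance_id_gaussianReal]
    simp only [NNReal.coe_sum]
    exact Finset.sum_congr rfl fun k _ => Real.coe_toNNReal _ (sq_nonneg _)
  rw [variance_of_integral_eq_zero hl.aemeasurable
    (by rw [hl.integral_eq, integral_id_gaussianReal])] at hv
  calc _ = ∑ k ∈ Finset.range n, a k ^ 2 := hv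
    _ ≤ _ := ha.sum_le_tsum _ fun k _ => sq_nonneg _

/-- A square summable combination of independent standard normal variables converges almost
surely, being an `L²`-bounded martingale. -/
lemma exists_ae_tendsto_partialSum (hlaw : ∀ k, HasLaw (ζ k) (gaussianReal 0 1) P)
    (hind : iIndepFun ζ P) {a : ℕ → ℝ} (ha : Summable fun k => a k ^ 2) :
    ∀ᵐ ω ∂P, ∃ x, Tendsto (fun n => partialSum ζ a n ω) atTop (𝓝 x) := by
  -- The natural filtration needs strongly measurable versions of the `ζ k`.
  let η : ℕ → Ω → ℝ := fun k => (hlaw k).aemeasurable.mk (ζ k)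
  have hη : ∀ k, ζ k =ᵐ[P] η k := fun k => (hlaw k).aemeasurable.ae_eq_mk
  have hηm : ∀ k, StronglyMeasurable (η k) := fun k =>
    (hlaw k).aemeasurable.measurable_mk.stronglyMeasurable
  have hηlaw : ∀ k, HasLaw (η k) (gaussianReal 0 1) P := fun k => (hlaw k).congr (hη k).symm
  have hηind : iIndepFun η P := hind.congr hη
  have hint : ∀ k, Integrable (η k) P := fun k => (hηlaw k).hasGaussianLaw.integrable
  have hmart : Martingale (fun n => partialSum η a (n + 1)) (Filtration.natural η hηm) P := by
    refine martingale_nat ?_ ?_ ?_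
    · intro n
      unfold partialSum
      refine Finset.stronglyMeasurable_fun_sum _ fun k hk => ?_
      exact (((Filtration.stronglyAdapted_natural hηm) k).mono
        ((Filtration.natural η hηm).mono (by simpa using Nat.lt_succ_iff.1 (Finset.mem_range.1 hk)))
        ).const_mul _
    · intro n
      exact (hasLaw_partialSum hηlaw hηind a (n + 1)).hasGaussianLaw.integrable
    · intro n
      have h1 : partialSum η a (n + 1 + 1)
          = partialSum η a (n + 1) + a (n + 1) • η (n + 1) := by
        ext ω; simp [partialSum, Finset.sum_range_succ _ (n + 1)]
      have hI := (hasLaw_partialSum hηlaw hηind a (n + 1)).hasGaussianLaw.integrable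
      rw [h1]
      have h2 := condExp_add hI ((hint (n + 1)).smul (a (n + 1))) (Filtration.natural η hηm n)
      have h3 := condExp_smul (μ := P) (a (n + 1)) (η (n + 1)) (Filtration.natural η hηm n)
      have h4 := hηind.condExp_natural_ae_eq_of_lt hηm (Nat.lt_succ_self n)
      have h5 : P[partialSum η a (n + 1) | Filtration.natural η hηm n]
          = partialSum η a (n + 1) := by
        refine condExp_of_stronglyMeasurable _ ?_ hI
        unfold partialSum
        refine Finset.stronglyMeasurable_fun_sum _ fun k hk => ?_
        exact (((Filtration.stronglyAdapted_natural hηm) k).mono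
          ((Filtration.natural η hηm).mono
            (by simpa using Nat.lt_succ_iff.1 (Finset.mem_range.1 hk)))).const_mul _
      have h6 : ∫ ω, η (n + 1) ω ∂P = 0 := by
        rw [(hηlaw _).integral_eq, integral_id_gaussianReal]
      filter_upwards [h2, h3, h4] with ω e2 e3 e4
      rw [e2, Pi.add_apply, e3, Pi.smul_apply, e4, h6, h5, smul_zero, add_zero]
  have hconv := hmart.submartingale.ae_tendsto_limitProcess (R := (√(∑' k, a k ^ 2)).toNNReal)
    fun n => (eLpNorm_le_eLpNorm_of_exponent_le (by norm_num)
      (aemeasurable_partialSum hηlaw a (n + 1)).aestronglyMeasurable).trans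
      (eLpNorm_partialSum_le hηlaw hηind ha (n + 1))
  filter_upwards [hconv, ae_all_iff.2 hη] with ω hω hω'
  refine ⟨_, (tendsto_add_atTop_iff_nat 1).1 (hω.congr fun n => ?_)⟩
  simp [partialSum, hω']

section Limit

variable {a b : ℕ → ℝ} {S T : Ω → ℝ}

/-- The sum of `∑ a_k ζ_k` has `L²` norm at most (in fact equal to) that of `a`. -/
lemma eLpNorm_le_of_ae_tendsto_partialSum (hlaw : ∀ k, HasLaw (ζ k) (gaussianReal 0 1) P)
    (hind : iIndepFun ζ P) (ha : Summable fun k => a k ^ 2)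
    (hS : ∀ᵐ ω ∂P, Tendsto (fun n => partialSum ζ a n ω) atTop (𝓝 (S ω))) :
    eLpNorm S 2 P ≤ ENNReal.ofReal √(∑' k, a k ^ 2) := by
  refine (Lp.eLpNorm_lim_le_liminf_eLpNorm
    (fun n => (aemeasurable_partialSum hlaw a n).aestronglyMeasurable) S hS).trans ?_
  exact liminf_le_of_frequently_le'
    (Frequently.of_forall fun n => eLpNorm_partialSum_le hlaw hind ha n)

lemma hasLaw_of_ae_tendsto_partialSum (hlaw : ∀ k, HasLaw (ζ k) (gaussianReal 0 1) P)
    (hind : iIndepFun ζ P) (ha : Summable fun k => a k ^ 2)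
    (hS : ∀ᵐ ω ∂P, Tendsto (fun n => partialSum ζ a n ω) atTop (𝓝 (S ω))) :
    HasLaw S (gaussianReal 0 (∑' k, a k ^ 2).toNNReal) P := by
  have hSm := aemeasurable_of_ae_tendsto_partialSum hlaw hS
  refine ⟨hSm, ?_⟩
  have : IsProbabilityMeasure (P.map S) := Measure.isProbabilityMeasure_map hSm
  apply Measure.ext_of_charFun
  ext u
  have key : ∀ X : Ω → ℝ, AEMeasurable X P →
      charFun (P.map X) u = ∫ ω, Complex.exp (u * X ω * Complex.I) ∂P := by
    intro X hX
    rw [charFun_apply_real, integral_map hX (by fun_prop)]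
  have h1 : Tendsto (fun n => charFun (P.map (partialSum ζ a n)) u) atTop
      (𝓝 (charFun (P.map S) u)) := by
    simp_rw [key _ (aemeasurable_partialSum hlaw a _), key _ hSm]
    refine tendsto_integral_of_dominated_convergence (fun _ => 1) ?_ (integrable_const _) ?_ ?_
    · intro n
      have := aemeasurable_partialSum hlaw a n
      exact AEMeasurable.aestronglyMeasurable (by fun_prop)
    · intro n
      refine ae_of_all _ fun ω => ?_
      rw [← Complex.ofReal_mul, Complex.norm_exp_ofReal_mul_I]
    · filter_upwards [hS] with ω hω
      have hc : Continuous fun x : ℝ => Complex.exp (u * x * Complex.I) := by fun_prop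
      exact (hc.tendsto _).comp hω
  have h2 : Tendsto (fun n => charFun (P.map (partialSum ζ a n)) u) atTop
      (𝓝 (charFun (gaussianReal 0 (∑' k, a k ^ 2).toNNReal) u)) := by
    simp_rw [(hasLaw_partialSum hlaw hind a _).map_eq, charFun_gaussianReal]
    have h3 : Tendsto (fun n => ∑ k ∈ Finset.range n, a k ^ 2) atTop (𝓝 (∑' k, a k ^ 2)) :=
      ha.hasSum.tendsto_sum_nat
    have hc : Continuous fun x : ℝ => Complex.exp (u * (0 : ℝ) * Complex.I - x * u ^ 2 / 2) := by
      fun_prop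
    have h4 := (hc.tendsto _).comp h3
    convert h4 using 2
    · rename_i n
      simp only [Function.comp]
      congr 4
      rw [NNReal.coe_sum, Complex.ofReal_sum, Complex.ofReal_sum]
      exact Finset.sum_congr rfl fun k _ => by rw [Real.coe_toNNReal _ (sq_nonneg _)]
    · rw [Real.coe_toNNReal _ (tsum_nonneg fun k => sq_nonneg _)]
  exact tendsto_nhds_unique h1 h2

lemma memLp_of_ae_tendsto_partialSum (hlaw : ∀ k, HasLaw (ζ k) (gaussianReal 0 1) P)
    (hind : iIndepFun ζ P) (ha : Summable fun k => a k ^ 2)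
    (hS : ∀ᵐ ω ∂P, Tendsto (fun n => partialSum ζ a n ω) atTop (𝓝 (S ω))) :
    MemLp S 2 P :=
  (hasLaw_of_ae_tendsto_partialSum hlaw hind ha hS).hasGaussianLaw.memLp_two

lemma integral_of_ae_tendsto_partialSum (hlaw : ∀ k, HasLaw (ζ k) (gaussianReal 0 1) P)
    (hind : iIndepFun ζ P) (ha : Summable fun k => a k ^ 2)
    (hS : ∀ᵐ ω ∂P, Tendsto (fun n => partialSum ζ a n ω) atTop (𝓝 (S ω))) :
    ∫ ω, S ω ∂P = 0 := by
  rw [(hasLaw_of_ae_tendsto_partialSum hlaw hind ha hS).integral_eq, integral_id_gaussianReal]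

lemma tendsto_eLpNorm_partialSum_sub (hlaw : ∀ k, HasLaw (ζ k) (gaussianReal 0 1) P)
    (hind : iIndepFun ζ P) (ha : Summable fun k => a k ^ 2)
    (hS : ∀ᵐ ω ∂P, Tendsto (fun n => partialSum ζ a n ω) atTop (𝓝 (S ω))) :
    Tendsto (fun n => eLpNorm (fun ω => partialSum ζ a n ω - S ω) 2 P) atTop (𝓝 0) := by
  -- `S` minus the `n`-th partial sum is the sum of the tail series
  let c : ℕ → ℕ → ℝ := fun n k => if k < n then 0 else a k
  have hc : ∀ n, Summable fun k => c n k ^ 2 := fun n =>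
    ha.of_nonneg_of_le (fun k => sq_nonneg _) fun k => by
      by_cases h : k < n <;> simp [c, h, sq_nonneg]
  have hlim : ∀ n, ∀ᵐ ω ∂P, Tendsto (fun m => partialSum ζ (c n) m ω) atTop
      (𝓝 (S ω - partialSum ζ a n ω)) := by
    intro n
    filter_upwards [hS] with ω hω
    refine (hω.sub_const _).congr' ?_
    filter_upwards [eventually_ge_atTop n] with m hm
    rw [partialSum, partialSum, partialSum, ← Finset.sum_range_add_sum_Ico _ hm,
      ← Finset.sum_range_add_sum_Ico _ hm, add_sub_cancel_left]
    have h0 : ∑ k ∈ Finset.range n, c n k * ζ k ω = 0 :=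
      Finset.sum_eq_zero fun k hk => by simp [c, Finset.mem_range.1 hk]
    rw [h0, zero_add]
    exact Finset.sum_congr rfl fun k hk => by
      simp [c, not_lt.2 (Finset.mem_Ico.1 hk).1]
  have htail : Tendsto (fun n => ∑' k, c n k ^ 2) atTop (𝓝 0) := by
    have := tendsto_sum_nat_add (fun k => a k ^ 2)
    refine this.congr fun n => ?_
    rw [← (hc n).sum_add_tsum_nat_add n, Finset.sum_eq_zero, zero_add]
    · simp [c]
    · intro k hk
      simp [c, Finset.mem_range.1 hk]
  refine tendsto_of_tendsto_of_tendsto_of_le_of_le tendsto_const_nhds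
    (h := fun n => ENNReal.ofReal √(∑' k, c n k ^ 2)) ?_ (fun n => zero_le) ?_
  · have := (ENNReal.continuous_ofReal.tendsto _).comp ((Real.continuous_sqrt.tendsto _).comp htail)
    simpa [Function.comp_def] using this
  · intro n
    beta_reduce
    have := eLpNorm_le_of_ae_tendsto_partialSum hlaw hind (hc n) (hlim n)
    rwa [← eLpNorm_neg, show (-fun ω => partialSum ζ a n ω - S ω)
      = fun ω => S ω - partialSum ζ a n ω by ext; simp]

lemma summable_sq_add (ha : Summable fun k => a k ^ 2) (hb : Summable fun k => b k ^ 2) :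
    Summable fun k => (a k + b k) ^ 2 :=
  ((ha.add hb).mul_left 2).of_nonneg_of_le (fun k => sq_nonneg _) fun k => by
    nlinarith [sq_nonneg (a k - b k)]

lemma summable_mul_of_sq (ha : Summable fun k => a k ^ 2) (hb : Summable fun k => b k ^ 2) :
    Summable fun k => a k * b k :=
  (ha.add hb).of_norm_bounded fun k => by
    rw [Real.norm_eq_abs, abs_le]
    constructor <;> nlinarith [sq_nonneg (a k - b k), sq_nonneg (a k + b k)]

/-- The covariance of two Gaussian series is the inner product of the coefficients. -/
lemma covariance_of_ae_tendsto_partialSum (hlaw : ∀ k, HasLaw (ζ k) (gaussianReal 0 1) P)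
    (hind : iIndepFun ζ P) (ha : Summable fun k => a k ^ 2) (hb : Summable fun k => b k ^ 2)
    (hS : ∀ᵐ ω ∂P, Tendsto (fun n => partialSum ζ a n ω) atTop (𝓝 (S ω)))
    (hT : ∀ᵐ ω ∂P, Tendsto (fun n => partialSum ζ b n ω) atTop (𝓝 (T ω))) :
    cov[S, T; P] = ∑' k, a k * b k := by
  have hvar : ∀ {c : ℕ → ℝ} {U : Ω → ℝ}, (Summable fun k => c k ^ 2) →
      (∀ᵐ ω ∂P, Tendsto (fun n => partialSum ζ c n ω) atTop (𝓝 (U ω))) →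
      Var[U; P] = ∑' k, c k ^ 2 := by
    intro c U hc hU
    rw [(hasLaw_of_ae_tendsto_partialSum hlaw hind hc hU).variance_eq, variance_id_gaussianReal,
      Real.coe_toNNReal _ (tsum_nonneg fun k => sq_nonneg _)]
  have hST : ∀ᵐ ω ∂P, Tendsto (fun n => partialSum ζ (fun k => a k + b k) n ω) atTop
      (𝓝 ((S + T) ω)) := by
    filter_upwards [hS, hT] with ω h1 h2
    simp_rw [partialSum_add]
    exact h1.add h2
  have h := variance_add (memLp_of_ae_tendsto_partialSum hlaw hind ha hS)
    (memLp_of_ae_tendsto_partialSum hlaw hind hb hT)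
  rw [hvar (summable_sq_add ha hb) hST, hvar ha hS, hvar hb hT] at h
  have hexp : ∑' k, (a k + b k) ^ 2
      = ∑' k, a k ^ 2 + 2 * ∑' k, a k * b k + ∑' k, b k ^ 2 := by
    have hab := summable_mul_of_sq ha hb
    rw [← tsum_mul_left, ← ha.tsum_add (hab.mul_left 2),
      ← (ha.add (hab.mul_left 2)).tsum_add hb]
    exact tsum_congr fun k => by ring
  linarith

end Limit

end GaussianSeries

/-! ### Moments of the product of points -/

section PowerSeries

/-- Identity theorem for absolutely convergent power series from one-sided information: dividing by
`z ^ n` and letting `z` decrease to `0` kills the coefficients one after the other. -/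
lemma coeff_eq_zero_of_tsum_eq_zero {c : ℕ → ℝ} (hc : Summable fun m => |c m|)
    (h : ∀ z : ℝ, 0 ≤ z → z < 1 → ∑' m, c m * z ^ m = 0) : c = 0 := by
  funext n
  induction n using Nat.strong_induction_on with
  | _ n ih =>
    have hcn : Summable fun m => |c (m + n)| := (summable_nat_add_iff n).2 hc
    have hcont : ContinuousOn (fun z : ℝ => ∑' m, c (m + n) * z ^ m) (Set.Icc 0 1) := by
      refine continuousOn_tsum (fun m => by fun_prop) hcn fun m z hz => ?_
      rw [Real.norm_eq_abs, abs_mul, abs_pow]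
      exact mul_le_of_le_one_right (abs_nonneg _)
        (pow_le_one₀ (abs_nonneg _) (abs_le.2 ⟨by linarith [hz.1], hz.2⟩))
    have hzero : ∀ z ∈ Set.Ioo (0 : ℝ) 1, ∑' m, c (m + n) * z ^ m = 0 := by
      intro z hz
      have hs : Summable fun m => c m * z ^ m := hc.of_norm_bounded fun m => by
        rw [Real.norm_eq_abs, abs_mul, abs_pow]
        exact mul_le_of_le_one_right (abs_nonneg _)
          (pow_le_one₀ (abs_nonneg _) (abs_le.2 ⟨by linarith [hz.1], hz.2.le⟩))
      have h1 := h z hz.1.le hz.2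
      rw [← hs.sum_add_tsum_nat_add n, Finset.sum_eq_zero fun i hi => by
        rw [ih i (Finset.mem_range.1 hi), Pi.zero_apply, zero_mul], zero_add] at h1
      have h2 : ∑' m, c (m + n) * z ^ (m + n) = z ^ n * ∑' m, c (m + n) * z ^ m := by
        rw [← tsum_mul_left]
        exact tsum_congr fun m => by ring
      rw [h2] at h1
      exact (mul_eq_zero.1 h1).resolve_left (pow_pos hz.1 n).ne'
    have hlim : Tendsto (fun z : ℝ => ∑' m, c (m + n) * z ^ m) (𝓝[Set.Ioo 0 1] 0)
        (𝓝 (∑' m, c (m + n) * (0 : ℝ) ^ m)) :=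
      ((hcont 0 (by simp)).mono_left (nhdsWithin_mono _ Set.Ioo_subset_Icc_self))
    have hlim0 : Tendsto (fun z : ℝ => ∑' m, c (m + n) * z ^ m) (𝓝[Set.Ioo 0 1] 0) (𝓝 0) :=
      tendsto_const_nhds.congr' (by
        filter_upwards [self_mem_nhdsWithin] with z hz using (hzero z hz).symm)
    have : (𝓝[Set.Ioo (0 : ℝ) 1] 0).NeBot := left_nhdsWithin_Ioo_neBot one_pos
    have := tendsto_nhds_unique hlim hlim0
    rw [tsum_eq_single 0 fun m hm => by rw [zero_pow hm, mul_zero]] at this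
    simpa using this

/-- If the square of a power series with nonnegative summable coefficients agrees on `[0, 1)` with
another one, then the two also agree on the rest of the closed unit interval, `-1` included. -/
lemma sq_tsum_eq_of_eq_on_Ico {a b : ℕ → ℝ} (ha : Summable a) (hb : Summable b)
    (ha0 : ∀ m, 0 ≤ a m) (hb0 : ∀ m, 0 ≤ b m)
    (h : ∀ z : ℝ, 0 ≤ z → z < 1 → (∑' m, a m * z ^ m) ^ 2 = ∑' m, b m * z ^ m)
    {z : ℝ} (hz : |z| ≤ 1) : (∑' m, a m * z ^ m) ^ 2 = ∑' m, b m * z ^ m := by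
  have hsum : ∀ {c : ℕ → ℝ}, Summable c → (∀ m, 0 ≤ c m) → ∀ {w : ℝ}, |w| ≤ 1 →
      Summable fun m => ‖c m * w ^ m‖ := by
    intro c hc hc0 w hw
    refine hc.of_nonneg_of_le (fun m => norm_nonneg _) fun m => ?_
    rw [Real.norm_eq_abs, abs_mul, abs_pow, abs_of_nonneg (hc0 m)]
    exact mul_le_of_le_one_right (hc0 m) (pow_le_one₀ (abs_nonneg _) hw)
  let q : ℕ → ℝ := fun n => ∑ kl ∈ Finset.HasAntidiagonal.antidiagonal n, a kl.1 * a kl.2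
  have hq0 : ∀ n, 0 ≤ q n := fun n => Finset.sum_nonneg fun kl _ => mul_nonneg (ha0 _) (ha0 _)
  have hq : Summable q := by
    have hn : Summable fun m => ‖a m‖ := by simpa [abs_of_nonneg (ha0 _)] using ha
    exact (summable_norm_sum_mul_antidiagonal_of_summable_norm hn hn).of_norm
  have hsq : ∀ {w : ℝ}, |w| ≤ 1 → (∑' m, a m * w ^ m) ^ 2 = ∑' n, q n * w ^ n := by
    intro w hw
    rw [sq, tsum_mul_tsum_eq_tsum_sum_antidiagonal_of_summable_norm (hsum ha ha0 hw)
      (hsum ha ha0 hw)]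
    refine tsum_congr fun n => ?_
    rw [Finset.sum_mul]
    refine Finset.sum_congr rfl fun kl hkl => ?_
    rw [← Finset.HasAntidiagonal.mem_antidiagonal.1 hkl, pow_add]
    ring
  have hqb : (fun n => q n - b n) = 0 := by
    refine coeff_eq_zero_of_tsum_eq_zero ?_ fun w hw0 hw1 => ?_
    · exact (hq.add hb).of_nonneg_of_le (fun m => abs_nonneg _) fun m =>
        abs_le.2 ⟨by linarith [hq0 m, hb0 m], by linarith [hq0 m, hb0 m]⟩
    · have hw : |w| ≤ 1 := abs_le.2 ⟨by linarith, hw1.le⟩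
      simp_rw [sub_mul]
      rw [(hsum hq hq0 hw).of_norm.tsum_sub (hsum hb hb0 hw).of_norm, ← hsq hw, h w hw0 hw1,
        sub_self]
  rw [hsq hz]
  exact tsum_congr fun n => by rw [sub_eq_zero.1 (congrFun hqb n)]

end PowerSeries

section PointProducts

/-- Infinite products of factors in `[0, 1]` converge unconditionally. -/
lemma multipliable_of_mem_unitInterval {f : ℕ → ℝ} (h0 : ∀ j, 0 ≤ f j) (h1 : ∀ j, f j ≤ 1) :
    Multipliable f := by
  refine ⟨⨅ s : Finset ℕ, ∏ j ∈ s, f j, ?_⟩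
  have hanti : Antitone fun s : Finset ℕ => ∏ j ∈ s, f j := Finset.prod_anti_set_of_le_one h0 h1
  simpa [HasProd] using tendsto_atTop_ciInf hanti
    ⟨0, by rintro _ ⟨s, rfl⟩; exact Finset.prod_nonneg fun j _ => h0 j⟩

variable {Ω : Type*} [MeasurableSpace Ω] (X : RandomPoints Ω)

open Classical in
/-- The number of negative points among the first `n` points. -/
def RandomPoints.negCount (n : ℕ) (ω : Ω) : ℕ :=
  ∑ j ∈ Finset.range n, if (j : ℕ∞) < X.count ω ∧ (X.pt j ω : ℝ) < 0 then 1 else 0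

/-- The number of negative points, possibly infinite. -/
def RandomPoints.negTotal (ω : Ω) : ℕ∞ := ⨆ n, (X.negCount n ω : ℕ∞)

/-- The product of the first `n` points. -/
def RandomPoints.partialProd (n : ℕ) (ω : Ω) : ℝ :=
  ∏ j ∈ Finset.range n, X.factor (fun ξ => (ξ : ℝ)) j ω

open Classical in
/-- The function `|ξ| ^ k`, with an extra weight `z` at the negative points. At `z = (-1) ^ k` it
is `ξ ^ k`. -/
def signWeight (k : ℕ) (z : ℝ) (ξ : SpinInterval) : ℝ :=
  if (ξ : ℝ) < 0 then z * |(ξ : ℝ)| ^ k else |(ξ : ℝ)| ^ k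

/-- `z ^ M`, with the value `0` at `M = ∞`. -/
def powTop (z : ℝ) (M : ℕ∞) : ℝ := if M = ⊤ then 0 else z ^ M.toNat

lemma RandomPoints.measurable_negCount (n : ℕ) : Measurable (X.negCount n) := by
  classical
  unfold RandomPoints.negCount
  refine Finset.measurable_fun_sum _ fun j _ => Measurable.ite ?_ measurable_const measurable_const
  exact (X.measurable_count (MeasurableSet.of_discrete (s := Set.Ioi (j : ℕ∞)))).inter
    (measurableSet_lt (measurable_subtype_coe.comp (X.measurable_pt j)) measurable_const)

lemma RandomPoints.measurable_negTotal : Measurable X.negTotal := by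
  have hle : ∀ m : ℕ∞, MeasurableSet {ω | X.negTotal ω ≤ m} := fun m => by
    have : {ω | X.negTotal ω ≤ m} = ⋂ n, X.negCount n ⁻¹' {j : ℕ | (j : ℕ∞) ≤ m} := by
      ext ω
      simp [RandomPoints.negTotal]
    rw [this]
    exact MeasurableSet.iInter fun n => X.measurable_negCount n
      (MeasurableSet.of_discrete (s := {j : ℕ | (j : ℕ∞) ≤ m}))
  refine measurable_to_countable' fun m => ?_
  have : X.negTotal ⁻¹' {m} = {ω | X.negTotal ω ≤ m} \ ⋃ j ∈ Set.Iio m, {ω | X.negTotal ω ≤ j} := by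
    ext ω
    simp only [Set.mem_preimage, Set.mem_singleton_iff, Set.mem_sdiff, Set.mem_ofPred_eq,
      Set.mem_iUnion, Set.mem_Iio, exists_prop, not_exists, not_and, not_le]
    constructor
    · rintro rfl
      exact ⟨le_rfl, fun j hj => hj⟩
    · rintro ⟨h1, h2⟩
      exact h1.eq_of_not_lt fun h => lt_irrefl _ (h2 _ h)
  rw [this]
  exact (hle m).diff (MeasurableSet.biUnion (Set.to_countable _) fun j _ => hle j)

lemma RandomPoints.measurable_partialProd (n : ℕ) : Measurable (X.partialProd n) := by
  unfold RandomPoints.partialProd RandomPoints.factor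
  refine Finset.measurable_fun_prod _ fun j _ => Measurable.ite ?_ ?_ measurable_const
  · exact X.measurable_count (MeasurableSet.of_discrete (s := Set.Ioi (j : ℕ∞)))
  · exact measurable_subtype_coe.comp (X.measurable_pt j)

lemma RandomPoints.monotone_negCount (ω : Ω) : Monotone fun n => X.negCount n ω := fun _ _ h =>
  Finset.sum_le_sum_of_subset (Finset.range_mono h)

lemma RandomPoints.abs_factor_le_one (j : ℕ) (ω : Ω) :
    |X.factor (fun ξ => (ξ : ℝ)) j ω| ≤ 1 := by
  unfold RandomPoints.factor
  split_ifs
  · exact abs_le.2 (X.pt j ω).2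
  · simp

lemma RandomPoints.abs_partialProd_le_one (n : ℕ) (ω : Ω) : |X.partialProd n ω| ≤ 1 := by
  rw [RandomPoints.partialProd, Finset.abs_prod]
  exact Finset.prod_le_one (fun _ _ => abs_nonneg _) fun j _ => X.abs_factor_le_one j ω

lemma RandomPoints.prod_factor_signWeight (k : ℕ) (z : ℝ) (n : ℕ) (ω : Ω) :
    ∏ j ∈ Finset.range n, X.factor (signWeight k z) j ω
      = z ^ X.negCount n ω * |X.partialProd n ω| ^ k := by
  induction n with
  | zero => simp [RandomPoints.negCount, RandomPoints.partialProd]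
  | succ n ih =>
    rw [Finset.prod_range_succ, ih]
    simp only [RandomPoints.negCount, RandomPoints.partialProd, Finset.sum_range_succ,
      Finset.prod_range_succ, RandomPoints.factor, signWeight, abs_mul, mul_pow, pow_add]
    by_cases h1 : (n : ℕ∞) < X.count ω
    · by_cases h2 : (X.pt n ω : ℝ) < 0
      · simp only [h1, h2, and_self, if_true]; ring
      · simp only [h1, h2, and_false, if_true, if_false]; ring
    · simp only [h1, false_and, if_false]; simp

lemma RandomPoints.partialProd_eq (n : ℕ) (ω : Ω) :
    X.partialProd n ω = (-1) ^ X.negCount n ω * |X.partialProd n ω| := by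
  have h := X.prod_factor_signWeight 1 (-1) n ω
  rw [pow_one] at h
  rw [← h]
  refine Finset.prod_congr rfl fun j _ => ?_
  unfold RandomPoints.factor signWeight
  split_ifs with h1 h2
  · rw [pow_one, abs_of_neg h2]; ring
  · rw [pow_one, abs_of_nonneg (not_lt.1 h2)]
  · rfl

lemma RandomPoints.eventually_negCount_eq {ω : Ω} (h : X.negTotal ω ≠ ⊤) :
    ∀ᶠ n in atTop, X.negCount n ω = (X.negTotal ω).toNat := by
  have hle : ∀ n, X.negCount n ω ≤ (X.negTotal ω).toNat := fun n => by
    have h1 : (X.negCount n ω : ℕ∞) ≤ X.negTotal ω := le_iSup (fun n => (X.negCount n ω : ℕ∞)) n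
    rw [← ENat.natCast_toNat h] at h1
    exact_mod_cast h1
  obtain ⟨N, hN⟩ : ∃ N, (X.negTotal ω).toNat ≤ X.negCount N ω := by
    by_contra! hcon
    have : X.negTotal ω ≤ (((X.negTotal ω).toNat - 1 : ℕ) : ℕ∞) := by
      refine iSup_le fun n => ?_
      have := hcon n
      exact_mod_cast (by omega : X.negCount n ω ≤ (X.negTotal ω).toNat - 1)
    have h0 := hcon 0
    rw [← ENat.natCast_toNat h] at this
    have : (X.negTotal ω).toNat ≤ (X.negTotal ω).toNat - 1 := by
      rw [ENat.toNat_natCast] at this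
      exact_mod_cast this
    omega
  filter_upwards [eventually_ge_atTop N] with n hn
  exact le_antisymm (hle n) (hN.trans (X.monotone_negCount ω hn))

lemma RandomPoints.tendsto_negCount {ω : Ω} (h : X.negTotal ω = ⊤) :
    Tendsto (fun n => X.negCount n ω) atTop atTop := by
  refine tendsto_atTop_atTop_of_monotone (X.monotone_negCount ω) fun b => ?_
  by_contra! hcon
  have : X.negTotal ω ≤ (b : ℕ∞) := iSup_le fun n => by exact_mod_cast (hcon n).le
  rw [h] at this
  exact absurd this (by simp)

lemma RandomPoints.tendsto_pow_negCount {z : ℝ} (h0 : 0 ≤ z) (h1 : z < 1) (ω : Ω) :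
    Tendsto (fun n => z ^ X.negCount n ω) atTop (𝓝 (powTop z (X.negTotal ω))) := by
  unfold powTop
  split_ifs with h
  · exact (tendsto_pow_atTop_nhds_zero_of_lt_one h0 h1).comp (X.tendsto_negCount h)
  · refine tendsto_const_nhds.congr' ?_
    filter_upwards [X.eventually_negCount_eq h] with n hn
    rw [hn]

section Limit

variable {X} {ω : Ω} {y : ℝ} (hy : HasProd (fun j => X.factor (fun ξ => (ξ : ℝ)) j ω) y)
include hy

lemma RandomPoints.tendsto_partialProd : Tendsto (fun n => X.partialProd n ω) atTop (𝓝 y) :=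
  hy.tendsto_prod_nat

/-- With infinitely many negative points the partial products change sign infinitely often, so that
they can converge only to `0`. -/
lemma RandomPoints.eq_zero_of_negTotal_eq_top (h : X.negTotal ω = ⊤) : y = 0 := by
  have hlim := RandomPoints.tendsto_partialProd hy
  have h2 : Tendsto (fun n => X.partialProd n ω * X.partialProd (n + 1) ω) atTop (𝓝 (y * y)) :=
    hlim.mul ((tendsto_add_atTop_iff_nat 1).2 hlim)
  have hfreq : ∃ᶠ n in atTop, X.partialProd n ω * X.partialProd (n + 1) ω ≤ 0 := by
    intro hev
    have hev' : ∀ᶠ n in atTop, X.negCount (n + 1) ω = X.negCount n ω := by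
      filter_upwards [hev] with n hn
      by_contra hne
      apply hn
      have hneg : (n : ℕ∞) < X.count ω ∧ (X.pt n ω : ℝ) < 0 := by
        by_contra hno
        exact hne (by simp only [RandomPoints.negCount, Finset.sum_range_succ, if_neg hno, add_zero])
      have : X.partialProd (n + 1) ω = X.partialProd n ω * (X.pt n ω : ℝ) := by
        simp only [RandomPoints.partialProd, Finset.prod_range_succ, RandomPoints.factor,
          if_pos hneg.1]
      rw [this, ← mul_assoc]
      exact mul_nonpos_of_nonneg_of_nonpos (mul_self_nonneg _) hneg.2.le
    obtain ⟨N, hN⟩ := eventually_atTop.1 hev'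
    have hconst : ∀ n, X.negCount (N + n) ω = X.negCount N ω := by
      intro n
      induction n with
      | zero => rfl
      | succ n ih => rw [← add_assoc, hN _ (by omega), ih]
    obtain ⟨n, hn⟩ := ((X.tendsto_negCount h).eventually_gt_atTop (X.negCount N ω)).and
      (eventually_ge_atTop N) |>.exists
    have := hconst (n - N)
    rw [Nat.add_sub_cancel' hn.2] at this
    omega
  have := le_of_tendsto_of_frequently h2 hfreq
  nlinarith [mul_self_nonneg y]

/-- A weight `z < 1` at the negative points makes the product vanish when there are infinitely many
of them, which is why `powTop z ⊤ = 0`. -/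
lemma RandomPoints.tprod_signWeight (k : ℕ) {z : ℝ} (h0 : 0 ≤ z) (h1 : z < 1) :
    ∏' j, X.factor (signWeight k z) j ω = powTop z (X.negTotal ω) * |y| ^ k := by
  have hmul : Multipliable fun j => X.factor (signWeight k z) j ω := by
    have habs : ∀ j, |(X.pt j ω : ℝ)| ^ k ≤ 1 := fun j =>
      pow_le_one₀ (abs_nonneg _) (abs_le.2 (X.pt j ω).2)
    refine multipliable_of_mem_unitInterval (fun j => ?_) fun j => ?_ <;>
      unfold RandomPoints.factor signWeight <;> split_ifs
    · positivity
    · positivity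
    · exact zero_le_one
    · exact mul_le_one₀ h1.le (by positivity) (habs j)
    · exact habs j
    · exact le_rfl
  refine tendsto_nhds_unique hmul.hasProd.tendsto_prod_nat ?_
  simp_rw [X.prod_factor_signWeight]
  exact (X.tendsto_pow_negCount h0 h1 ω).mul ((RandomPoints.tendsto_partialProd hy).abs.pow k)

/-- The identity of `tprod_signWeight` at the boundary value `z = (-1) ^ k`. -/
lemma RandomPoints.pow_eq {k : ℕ} (hk : k ≠ 0) :
    y ^ k = powTop ((-1) ^ k) (X.negTotal ω) * |y| ^ k := by
  by_cases h : X.negTotal ω = ⊤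
  · rw [RandomPoints.eq_zero_of_negTotal_eq_top hy h]
    simp [hk]
  · have hlim := RandomPoints.tendsto_partialProd hy
    have h2 : y = (-1) ^ (X.negTotal ω).toNat * |y| := by
      refine tendsto_nhds_unique hlim ((hlim.abs.const_mul _).congr' ?_)
      filter_upwards [X.eventually_negCount_eq h] with n hn
      conv_rhs => rw [X.partialProd_eq, hn]
    conv_lhs => rw [h2]
    rw [powTop, if_neg h, mul_pow, ← pow_mul, ← pow_mul, mul_comm k]

lemma RandomPoints.abs_le_one : |y| ≤ 1 :=
  le_of_tendsto' (RandomPoints.tendsto_partialProd hy).abs fun n => X.abs_partialProd_le_one n ω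

end Limit

lemma IsProductOfPoints.aemeasurable {Q : Measure Ω} {ν : Measure SpinInterval} {φ : ℝ} {Y : Ω → ℝ}
    (h : IsProductOfPoints Q ν φ Y) : AEMeasurable Y Q := by
  obtain ⟨X, -, hX⟩ := h
  refine aemeasurable_of_tendsto_metrizable_ae atTop
    (fun n => (X.measurable_partialProd n).aemeasurable) ?_
  filter_upwards [hX] with ω hω using RandomPoints.tendsto_partialProd hω

lemma IsProductOfPoints.ae_abs_le_one {Q : Measure Ω} {ν : Measure SpinInterval} {φ : ℝ} {Y : Ω → ℝ}
    (h : IsProductOfPoints Q ν φ Y) : ∀ᵐ ω ∂Q, |Y ω| ≤ 1 := by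
  obtain ⟨X, -, hX⟩ := h
  filter_upwards [hX] with ω hω using RandomPoints.abs_le_one hω

lemma measurable_signWeight (k : ℕ) (z : ℝ) : Measurable (signWeight k z) := by
  unfold signWeight
  exact Measurable.ite (measurableSet_lt measurable_subtype_coe measurable_const)
    (by fun_prop) (by fun_prop)

lemma signWeight_mem (k : ℕ) {z : ℝ} (h0 : 0 ≤ z) (h1 : z ≤ 1) (ξ : SpinInterval) :
    0 ≤ signWeight k z ξ ∧ signWeight k z ξ ≤ 1 := by
  have habs : |(ξ : ℝ)| ^ k ≤ 1 := pow_le_one₀ (abs_nonneg _) (abs_le.2 ξ.2)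
  unfold signWeight
  split_ifs
  · exact ⟨by positivity, mul_le_one₀ h1 (by positivity) habs⟩
  · exact ⟨by positivity, habs⟩

lemma integrable_one_sub_signWeight {ν : Measure SpinInterval}
    (hν : Integrable (fun ξ : SpinInterval => 1 - (ξ : ℝ)) ν) (k : ℕ) {z : ℝ} (h0 : 0 ≤ z)
    (h1 : z ≤ 1) : Integrable (fun ξ => 1 - signWeight k z ξ) ν := by
  refine (hν.const_mul (k + 1)).mono'
    (measurable_const.sub (measurable_signWeight k z)).aestronglyMeasurable (ae_of_all _ fun ξ => ?_)
  have hmem := signWeight_mem k h0 h1 ξ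
  rw [Real.norm_eq_abs, abs_of_nonneg (by linarith [hmem.2])]
  have hξ := ξ.2
  by_cases hneg : (ξ : ℝ) < 0
  · nlinarith [hmem.1, hξ.2, (Nat.cast_nonneg k : (0 : ℝ) ≤ k)]
  · rw [not_lt] at hneg
    rw [signWeight, if_neg (not_lt.2 hneg), abs_of_nonneg hneg]
    have := one_add_mul_le_pow (a := (ξ : ℝ) - 1) (by linarith) k
    rw [add_sub_cancel] at this
    nlinarith [hξ.2]

/-- The moments of a product of points, and its generating functional at `signWeight k z`, are the
values of one power series: its coefficients are the contributions to `E|Y|^k` of the numbers of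
negative points. -/
lemma IsProductOfPoints.exists_powerSeries {Q : Measure Ω} [IsProbabilityMeasure Q]
    {ν : Measure SpinInterval} (hν : Integrable (fun ξ : SpinInterval => 1 - (ξ : ℝ)) ν)
    {φ : ℝ} {Y : Ω → ℝ} (h : IsProductOfPoints Q ν φ Y) {k : ℕ} (hk : k ≠ 0) :
    ∃ a : ℕ → ℝ, Summable a ∧ (∀ m, 0 ≤ a m) ∧
      (∀ z : ℝ, 0 ≤ z → z < 1 → genFunctional ν (signWeight k z) ^ φ = ∑' m, a m * z ^ m) ∧
      rawMoment Q Y k = ∑' m, a m * ((-1) ^ k) ^ m := by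
  have hYm := h.aemeasurable
  have hY1 := h.ae_abs_le_one
  obtain ⟨X, hX, hXY⟩ := h
  classical
  -- With infinitely many negative points `Y = 0`, so only the events of a finite number contribute.
  let A : ℕ → Set Ω := fun m => {ω | X.negTotal ω = (m : ℕ∞)}
  have hA : ∀ m, MeasurableSet (A m) := fun m => X.measurable_negTotal (measurableSet_singleton _)
  have hdisj : Pairwise (Function.onFun Disjoint A) := by
    intro i j hij
    refine Set.disjoint_left.2 fun ω hi hj => hij ?_
    have : (i : ℕ∞) = j := hi.symm.trans hj
    exact_mod_cast this
  have hint : Integrable (fun ω => |Y ω| ^ k) Q := by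
    refine Integrable.of_bound (C := 1) (by fun_prop) ?_
    filter_upwards [hY1] with ω hω
    rw [Real.norm_eq_abs, abs_pow, abs_abs]
    exact pow_le_one₀ (abs_nonneg _) hω
  have hsum : HasSum (fun m => ∫ ω in A m, |Y ω| ^ k ∂Q) (∫ ω in ⋃ m, A m, |Y ω| ^ k ∂Q) :=
    hasSum_integral_iUnion hA hdisj hint.integrableOn
  have ha0 : ∀ m, 0 ≤ ∫ ω in A m, |Y ω| ^ k ∂Q := fun m => integral_nonneg fun ω => by positivity
  have key : ∀ z : ℝ, |z| ≤ 1 → ∫ ω, powTop z (X.negTotal ω) * |Y ω| ^ k ∂Q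
      = ∑' m, (∫ ω in A m, |Y ω| ^ k ∂Q) * z ^ m := by
    intro z hz
    have h1 : ∀ m, Integrable (fun ω => (A m).indicator (fun ω => |Y ω| ^ k) ω * z ^ m) Q :=
      fun m => (hint.indicator (hA m)).mul_const _
    have h2 := hasSum_integral_of_summable_integral_norm h1 (by
      refine hsum.summable.of_nonneg_of_le (fun m => by positivity) fun m => ?_
      rw [← integral_indicator (hA m)]
      refine integral_mono (h1 m).norm (hint.indicator (hA m)) fun ω => ?_
      rw [norm_mul, norm_pow, Real.norm_eq_abs, Real.norm_eq_abs, abs_of_nonneg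
        (Set.indicator_nonneg (fun _ _ => by positivity) _)]
      exact mul_le_of_le_one_right (Set.indicator_nonneg (fun _ _ => by positivity) _)
        (pow_le_one₀ (abs_nonneg _) hz))
    simp_rw [integral_mul_const, integral_indicator (hA _)] at h2
    rw [h2.tsum_eq]
    refine integral_congr_ae (ae_of_all _ fun ω => ?_)
    beta_reduce
    by_cases htop : X.negTotal ω = ⊤
    · rw [powTop, if_pos htop, zero_mul]
      refine tsum_zero.symm.trans (tsum_congr fun m => ?_)
      rw [Set.indicator_of_notMem, zero_mul]
      intro hmem
      rw [show X.negTotal ω = (m : ℕ∞) from hmem] at htop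
      exact ENat.natCast_ne_top m htop
    · rw [tsum_eq_single (X.negTotal ω).toNat, powTop, if_neg htop, Set.indicator_of_mem, mul_comm]
      · exact (ENat.natCast_toNat htop).symm
      · intro m hm
        rw [Set.indicator_of_notMem, zero_mul]
        intro hmem
        apply hm
        rw [show X.negTotal ω = (m : ℕ∞) from hmem, ENat.toNat_natCast]
  refine ⟨fun m => ∫ ω in A m, |Y ω| ^ k ∂Q, hsum.summable, ha0, fun z h0 h1 => ?_, ?_⟩
  · rw [← key z (abs_le.2 ⟨by linarith, h1.le⟩), ← hX _ (measurable_signWeight k z)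
      (signWeight_mem k h0 h1.le) (integrable_one_sub_signWeight hν k h0 h1.le)]
    refine integral_congr_ae ?_
    filter_upwards [hXY] with ω hω
    exact RandomPoints.tprod_signWeight hω k h0 h1
  · rw [← key _ (by simp)]
    refine integral_congr_ae ?_
    filter_upwards [hXY] with ω hω
    exact RandomPoints.pow_eq hω hk

lemma genFunctional_nonneg {ν : Measure SpinInterval} {f : SpinInterval → ℝ}
    (hf : ∀ ξ, f ξ ≤ 1) : 0 ≤ genFunctional ν f := by
  have : 0 ≤ ∫ ξ, (1 - f ξ) ∂ν := integral_nonneg fun ξ => sub_nonneg.2 (hf ξ)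
  unfold genFunctional
  positivity

/-- `E[Y_{1/2}^k]^2 = E[Y^k]`, at odd `k` too, where the generating functional does not apply
directly. -/
theorem sq_rawMoment_half {ν : Measure SpinInterval}
    (hν : Integrable (fun ξ : SpinInterval => 1 - (ξ : ℝ)) ν)
    {ΩY : Type*} [MeasurableSpace ΩY] {QY : Measure ΩY} [IsProbabilityMeasure QY]
    {Y : ΩY → ℝ} (hY : IsProductOfPoints QY ν 1 Y)
    {ΩH : Type*} [MeasurableSpace ΩH] {QH : Measure ΩH} [IsProbabilityMeasure QH]
    {Yhalf : ΩH → ℝ} (hYhalf : IsProductOfPoints QH ν (1 / 2) Yhalf) (k : ℕ) :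
    rawMoment QH Yhalf k ^ 2 = rawMoment QY Y k := by
  rcases eq_or_ne k 0 with rfl | hk
  · simp [rawMoment]
  obtain ⟨a, ha, ha0, hag, ham⟩ := hYhalf.exists_powerSeries hν hk
  obtain ⟨b, hb, hb0, hbg, hbm⟩ := hY.exists_powerSeries hν hk
  rw [ham, hbm]
  refine sq_tsum_eq_of_eq_on_Ico ha hb ha0 hb0 (fun z h0 h1 => ?_) (by simp)
  rw [← hag z h0 h1, ← hbg z h0 h1, ← Real.rpow_natCast, ← Real.rpow_mul
    (genFunctional_nonneg fun ξ => (signWeight_mem k h0 h1.le ξ).2)]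
  norm_num

end PointProducts

/-! ### Integrability at both endpoints -/

section NegativeMoments

variable {Ω : Type*} [MeasurableSpace Ω] {Q : Measure Ω} {Y : Ω → ℝ}

lemma ofReal_rpow_neg_half {x : ℝ} (hx : 0 < x) :
    ENNReal.ofReal x ^ (-(1 / 2) : ℝ) = ENNReal.ofReal (√x)⁻¹ := by
  rw [ENNReal.ofReal_rpow_of_pos hx, Real.rpow_neg hx.le, Real.sqrt_eq_rpow]

/-- `x ^ (-1/2)` as a mixture of exponentials `e ^ (-x u²)`. -/
lemma ofReal_inv_sqrt_eq_lintegral {x : ℝ} (hx : 0 < x) :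
    ENNReal.ofReal (√x)⁻¹
      = ENNReal.ofReal (√Real.pi)⁻¹ * ∫⁻ u : ℝ, ENNReal.ofReal (Real.exp (-x * u ^ 2)) := by
  rw [← ofReal_integral_eq_lintegral_ofReal (integrable_exp_neg_mul_sq hx)
    (ae_of_all _ fun u => (Real.exp_pos _).le), integral_gaussian, ← ENNReal.ofReal_mul
    (by positivity), Real.sqrt_div Real.pi_pos.le]
  congr 1
  have : √Real.pi ≠ 0 := (Real.sqrt_pos.2 Real.pi_pos).ne'
  field_simp

lemma ae_lt_one_of_lintegral_lt_top (hYm : AEMeasurable Y Q) (hY1 : ∀ᵐ ω ∂Q, |Y ω| ≤ 1)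
    (hfin : ∫⁻ ω, (ENNReal.ofReal (1 - Y ω)) ^ (-(1 / 2) : ℝ) ∂Q < ⊤) : ∀ᵐ ω ∂Q, Y ω < 1 := by
  have hm : AEMeasurable (fun ω => (ENNReal.ofReal (1 - Y ω)) ^ (-(1 / 2) : ℝ)) Q := by fun_prop
  filter_upwards [ae_lt_top' hm hfin.ne, hY1] with ω h1 h2
  refine lt_of_le_of_ne (abs_le.1 h2).2 fun h => ?_
  rw [h, sub_self, ENNReal.ofReal_zero, ENNReal.zero_rpow_of_neg (by norm_num)] at h1
  exact lt_irrefl _ h1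

variable [IsProbabilityMeasure Q]

/-- Nonnegative odd moments leave no room for an atom at `-1` in the absence of one at `1`. -/
lemma ae_abs_lt_one (hYm : AEMeasurable Y Q) (hY1 : ∀ᵐ ω ∂Q, |Y ω| ≤ 1)
    (hlt : ∀ᵐ ω ∂Q, Y ω < 1) (hmom : ∀ k, 0 ≤ rawMoment Q Y k) : ∀ᵐ ω ∂Q, |Y ω| < 1 := by
  let f : Ω → ℝ := fun ω => if Y ω = -1 then -1 else 0
  have hlim : Tendsto (fun n => ∫ ω, Y ω ^ (2 * n + 1) ∂Q) atTop (𝓝 (∫ ω, f ω ∂Q)) := by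
    refine tendsto_integral_of_dominated_convergence (fun _ => 1)
      (fun n => (hYm.pow_const _).aestronglyMeasurable) (integrable_const _) (fun n => ?_) ?_
    · filter_upwards [hY1] with ω hω
      rw [norm_pow]
      exact pow_le_one₀ (norm_nonneg _) hω
    · filter_upwards [hY1, hlt] with ω h1 h2
      by_cases h : Y ω = -1
      · simp [f, h, pow_succ, pow_mul]
      · simp only [f, if_neg h]
        have : |Y ω| < 1 := abs_lt.2 ⟨lt_of_le_of_ne (abs_le.1 h1).1 (Ne.symm h), h2⟩
        refine (tendsto_pow_atTop_nhds_zero_of_abs_lt_one this).comp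
          (tendsto_atTop_mono (fun n => ?_) tendsto_id)
        simp only [id]; omega
  have h0 : 0 ≤ ∫ ω, f ω ∂Q := ge_of_tendsto' hlim fun n => hmom _
  have hfm : AEStronglyMeasurable f Q := by
    have : Measurable fun y : ℝ => if y = -1 then (-1 : ℝ) else 0 :=
      Measurable.ite (measurableSet_singleton _) measurable_const measurable_const
    exact (this.comp_aemeasurable hYm).aestronglyMeasurable
  have hfi : Integrable f Q := Integrable.of_bound hfm 1 (ae_of_all _ fun ω => by
    simp only [f]; split_ifs <;> simp)
  have hneg : 0 ≤ fun ω => -f ω := fun ω => by simp only [f]; split_ifs <;> simp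
  have hz : ∫ ω, -f ω ∂Q = 0 := le_antisymm (by rw [integral_neg]; linarith) (integral_nonneg hneg)
  have hae := (integral_eq_zero_iff_of_nonneg hneg hfi.neg).1 hz
  filter_upwards [hae, hY1, hlt] with ω h h1 h2
  refine abs_lt.2 ⟨lt_of_le_of_ne (abs_le.1 h1).1 fun he => ?_, h2⟩
  simp [f, ← he] at h

lemma integrable_exp_mul_of_abs_le_one (hYm : AEMeasurable Y Q) (hY1 : ∀ᵐ ω ∂Q, |Y ω| ≤ 1)
    (u : ℝ) : Integrable (fun ω => Real.exp (Y ω * u)) Q := by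
  refine Integrable.of_bound (by fun_prop) (Real.exp |u|) ?_
  filter_upwards [hY1] with ω hω
  rw [Real.norm_eq_abs, Real.abs_exp]
  refine Real.exp_le_exp.2 ((le_abs_self _).trans ?_)
  rw [abs_mul]
  exact mul_le_of_le_one_left (abs_nonneg _) hω

/-- The difference of the two sides is twice the series of the odd moments. -/
lemma integral_exp_neg_le (hYm : AEMeasurable Y Q) (hY1 : ∀ᵐ ω ∂Q, |Y ω| ≤ 1)
    (hmom : ∀ k, 0 ≤ rawMoment Q Y k) {u : ℝ} (hu : 0 ≤ u) :
    ∫ ω, Real.exp (Y ω * -u) ∂Q ≤ ∫ ω, Real.exp (Y ω * u) ∂Q := by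
  have hterm : ∀ n : ℕ, Integrable (fun ω => (Y ω * u) ^ (2 * n + 1) / (2 * n + 1).factorial) Q := by
    intro n
    refine Integrable.of_bound (by fun_prop) (u ^ (2 * n + 1) / (2 * n + 1).factorial) ?_
    filter_upwards [hY1] with ω hω
    rw [norm_div, norm_pow, norm_mul, Real.norm_eq_abs, Real.norm_eq_abs, abs_of_nonneg hu,
      Real.norm_natCast]
    gcongr
    exact mul_le_of_le_one_left hu hω
  have hbound : ∀ n : ℕ, ∫ ω, ‖(Y ω * u) ^ (2 * n + 1) / ((2 * n + 1).factorial : ℝ)‖ ∂Q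
      ≤ u ^ (2 * n + 1) / (2 * n + 1).factorial := by
    intro n
    have := integral_mono_ae (hterm n).norm
      (integrable_const (u ^ (2 * n + 1) / ((2 * n + 1).factorial : ℝ))) (by
        filter_upwards [hY1] with ω hω
        rw [norm_div, norm_pow, norm_mul, Real.norm_eq_abs, Real.norm_eq_abs, abs_of_nonneg hu,
          Real.norm_natCast]
        gcongr
        exact mul_le_of_le_one_left hu hω)
    simpa using this
  have hs := hasSum_integral_of_summable_integral_norm hterm
    ((Real.hasSum_sinh u).summable.of_nonneg_of_le
      (fun n => integral_nonneg fun ω => norm_nonneg _) hbound)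
  have h0 : 0 ≤ ∫ ω, Real.sinh (Y ω * u) ∂Q := by
    simp_rw [(Real.hasSum_sinh _).tsum_eq] at hs
    rw [← hs.tsum_eq]
    refine tsum_nonneg fun n => ?_
    simp_rw [mul_pow, mul_div_assoc, integral_mul_const]
    exact mul_nonneg (hmom _) (by positivity)
  simp_rw [Real.sinh_eq, ← mul_neg] at h0
  rw [integral_div, integral_sub (integrable_exp_mul_of_abs_le_one hYm hY1 u)
    (integrable_exp_mul_of_abs_le_one hYm hY1 (-u))] at h0
  linarith

/-- When all moments are nonnegative, `Y` is no more concentrated near `-1` than near `1`. -/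
lemma lintegral_inv_sqrt_one_add_le (hYm : AEMeasurable Y Q) (hYlt : ∀ᵐ ω ∂Q, |Y ω| < 1)
    (hmom : ∀ k, 0 ≤ rawMoment Q Y k) :
    ∫⁻ ω, ENNReal.ofReal (√(1 + Y ω))⁻¹ ∂Q ≤ ∫⁻ ω, ENNReal.ofReal (√(1 - Y ω))⁻¹ ∂Q := by
  have hY1 : ∀ᵐ ω ∂Q, |Y ω| ≤ 1 := hYlt.mono fun _ h => h.le
  have hswap : ∀ σ : ℝ, |σ| = 1 → ∫⁻ ω, ENNReal.ofReal (√(1 - σ * Y ω))⁻¹ ∂Q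
      = ENNReal.ofReal (√Real.pi)⁻¹ * ∫⁻ u : ℝ, ENNReal.ofReal (Real.exp (-u ^ 2)) *
        ENNReal.ofReal (∫ ω, Real.exp (Y ω * (σ * u ^ 2)) ∂Q) := by
    intro σ hσ
    have h1 : ∀ᵐ ω ∂Q, ENNReal.ofReal (√(1 - σ * Y ω))⁻¹ = ENNReal.ofReal (√Real.pi)⁻¹ *
        ∫⁻ u : ℝ, ENNReal.ofReal (Real.exp (-(1 - σ * Y ω) * u ^ 2)) := by
      filter_upwards [hYlt] with ω hω
      refine ofReal_inv_sqrt_eq_lintegral (sub_pos.2 ((le_abs_self _).trans_lt ?_))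
      rwa [abs_mul, hσ, one_mul]
    have hmeas : AEMeasurable (Function.uncurry fun (ω : Ω) (u : ℝ) =>
        ENNReal.ofReal (Real.exp (-(1 - σ * Y ω) * u ^ 2))) (Q.prod volume) := by
      have : AEMeasurable (fun p : Ω × ℝ => Y p.1) (Q.prod volume) := hYm.comp_fst
      unfold Function.uncurry
      fun_prop
    rw [lintegral_congr_ae h1, lintegral_const_mul' _ _ ENNReal.ofReal_ne_top,
      lintegral_lintegral_swap hmeas]
    congr 1
    refine lintegral_congr fun u => ?_
    rw [ofReal_integral_eq_lintegral_ofReal (integrable_exp_mul_of_abs_le_one hYm hY1 _)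
      (ae_of_all _ fun ω => (Real.exp_pos _).le), ← lintegral_const_mul' _ _ ENNReal.ofReal_ne_top]
    refine lintegral_congr fun ω => ?_
    rw [← ENNReal.ofReal_mul (Real.exp_pos _).le, ← Real.exp_add]
    congr 2
    ring
  have hp := hswap 1 (by simp)
  have hn := hswap (-1) (by simp)
  simp only [one_mul, neg_mul, sub_neg_eq_add] at hp hn
  rw [hp, hn]
  exact mul_le_mul' le_rfl (lintegral_mono fun u => mul_le_mul' le_rfl
    (ENNReal.ofReal_le_ofReal (integral_exp_neg_le hYm hY1 hmom (sq_nonneg u))))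

theorem integrable_inv_sqrt_one_sub_sq (hYm : AEMeasurable Y Q) (hYlt : ∀ᵐ ω ∂Q, |Y ω| < 1)
    (hmom : ∀ k, 0 ≤ rawMoment Q Y k)
    (hfin : ∫⁻ ω, (ENNReal.ofReal (1 - Y ω)) ^ (-(1 / 2) : ℝ) ∂Q < ⊤) :
    Integrable (fun ω => (√(1 - Y ω ^ 2))⁻¹) Q := by
  have h1 : ∫⁻ ω, ENNReal.ofReal (√(1 - Y ω))⁻¹ ∂Q < ⊤ := by
    rwa [← lintegral_congr_ae (f := fun ω => (ENNReal.ofReal (1 - Y ω)) ^ (-(1 / 2) : ℝ))]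
    filter_upwards [hYlt] with ω hω
    exact ofReal_rpow_neg_half (by linarith [(abs_lt.1 hω).2])
  have h2 := (lintegral_inv_sqrt_one_add_le hYm hYlt hmom).trans_lt h1
  refine ⟨AEMeasurable.aestronglyMeasurable (by fun_prop), ?_⟩
  rw [hasFiniteIntegral_iff_ofReal (ae_of_all _ fun ω => by positivity)]
  refine lt_of_le_of_lt (lintegral_mono_ae ?_) ?_ (b := ∫⁻ ω, (ENNReal.ofReal (√(1 - Y ω))⁻¹ +
    ENNReal.ofReal (√(1 + Y ω))⁻¹) ∂Q)
  · filter_upwards [hYlt] with ω hω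
    obtain ⟨ha, hb⟩ := abs_lt.1 hω
    rw [← ENNReal.ofReal_add (by positivity) (by positivity)]
    apply ENNReal.ofReal_le_ofReal
    rcases le_total 0 (Y ω) with h | h
    · refine le_add_of_le_of_nonneg ?_ (by positivity)
      have : 0 < √(1 - Y ω) := Real.sqrt_pos.2 (by linarith)
      gcongr
      nlinarith
    · refine le_add_of_nonneg_of_le (by positivity) ?_
      have : 0 < √(1 + Y ω) := Real.sqrt_pos.2 (by linarith)
      gcongr
      nlinarith
  · rw [lintegral_add_left' (by fun_prop)]
    exact ENNReal.add_lt_top.2 ⟨h1, h2⟩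

end NegativeMoments

/-! ### Mehler's formula -/

section Mehler

lemma hermiteH_succ (k : ℕ) (t : ℝ) :
    hermiteH (k + 1) t = t * hermiteH k t
      - Polynomial.aeval t (Polynomial.derivative (Polynomial.hermite k)) := by
  simp [hermiteH, Polynomial.hermite_succ]

/-- Rodrigues' formula, with `e^{-t²/2}` as the characteristic function of the normal law. -/
lemma iteratedDeriv_charFun_gaussian (k : ℕ) (t : ℝ) :
    iteratedDeriv k (charFun (gaussianReal 0 1)) t
      = (((-1) ^ k * hermiteH k t * Real.exp (-t ^ 2 / 2) : ℝ) : ℂ) := by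
  induction k generalizing t with
  | zero =>
    rw [iteratedDeriv_zero, charFun_gaussianReal]
    simp [hermiteH, neg_div]
  | succ k ih =>
    rw [iteratedDeriv_succ, funext ih]
    have h1 : HasDerivAt (fun t : ℝ => Real.exp (-t ^ 2 / 2)) (Real.exp (-t ^ 2 / 2) * -t) t := by
      have : HasDerivAt (fun t : ℝ => -t ^ 2 / 2) (-t) t := by
        refine ((hasDerivAt_pow 2 t).neg.div_const 2).congr_deriv ?_
        norm_num
        ring
      exact this.exp
    have h2 : HasDerivAt (fun t => (-1) ^ k * hermiteH k t)
        ((-1) ^ k * Polynomial.aeval t (Polynomial.derivative (Polynomial.hermite k))) t :=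
      ((Polynomial.hermite k).hasDerivAt_aeval t).const_mul _
    have h3 : HasDerivAt (fun t : ℝ => (((-1) ^ k * hermiteH k t * Real.exp (-t ^ 2 / 2) : ℝ) : ℂ)) _
        t := (h2.mul h1).ofReal_comp
    rw [h3.deriv, hermiteH_succ]
    congr 1
    ring

/-- The coefficient `(2π)^{-1/2} e^{-t²/2} H_k(t) / √k!` of the Gaussian series. -/
def hermiteCoeff (t : ℝ) (k : ℕ) : ℝ :=
  1 / √(2 * Real.pi) * Real.exp (-t ^ 2 / 2) * (1 / √(k.factorial : ℝ)) * hermiteH k t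

lemma hermiteCoeff_mul (t s : ℝ) (k : ℕ) :
    hermiteCoeff t k * hermiteCoeff s k = 1 / (2 * Real.pi) * Real.exp (-(t ^ 2 + s ^ 2) / 2) *
      (1 / (k.factorial : ℝ) * hermiteH k t * hermiteH k s) := by
  have h1 : (1 / √(2 * Real.pi)) * (1 / √(2 * Real.pi)) = 1 / (2 * Real.pi) := by
    rw [div_mul_div_comm, one_mul, Real.mul_self_sqrt (by positivity)]
  have h2 : (1 / √(k.factorial : ℝ)) * (1 / √(k.factorial : ℝ)) = 1 / (k.factorial : ℝ) := by
    rw [div_mul_div_comm, one_mul, Real.mul_self_sqrt (by positivity)]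
  have h3 : Real.exp (-t ^ 2 / 2) * Real.exp (-s ^ 2 / 2) = Real.exp (-(t ^ 2 + s ^ 2) / 2) := by
    rw [← Real.exp_add]; congr 1; ring
  rw [← h1, ← h2, ← h3, hermiteCoeff, hermiteCoeff]
  ring

/-- Differentiating the characteristic function under the expectation turns the coefficients into
products of one-dimensional Gaussian integrals. -/
lemma ofReal_hermiteCoeff_mul (t s : ℝ) (k : ℕ) :
    ((hermiteCoeff t k * hermiteCoeff s k : ℝ) : ℂ) = 1 / (2 * Real.pi) * ((-1) ^ k / k.factorial *
      ((∫ x : ℝ, (x : ℂ) ^ k * Complex.exp (t * x * Complex.I) ∂gaussianReal 0 1) *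
        ∫ x : ℝ, (x : ℂ) ^ k * Complex.exp (s * x * Complex.I) ∂gaussianReal 0 1)) := by
  have hm : MemLp (id : ℝ → ℝ) (k : NNReal) (gaussianReal 0 1) := memLp_id_gaussianReal k
  have hm' : MemLp (id : ℝ → ℝ) (k : ENNReal) (gaussianReal 0 1) := by exact_mod_cast hm
  have ht := (iteratedDeriv_charFun (t := t) hm').symm.trans (iteratedDeriv_charFun_gaussian k t)
  have hs := (iteratedDeriv_charFun (t := s) hm').symm.trans (iteratedDeriv_charFun_gaussian k s)
  have hI : Complex.I ^ k * Complex.I ^ k = (-1) ^ k := by rw [← mul_pow, Complex.I_mul_I]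
  have h1 : ((-1 : ℂ) ^ k) * (-1) ^ k = 1 := by rw [← mul_pow]; simp
  have hexp : (Real.exp (-(t ^ 2 + s ^ 2) / 2) : ℝ)
      = Real.exp (-t ^ 2 / 2) * Real.exp (-s ^ 2 / 2) := by
    rw [← Real.exp_add]; congr 1; ring
  have hmul := congrArg₂ (· * ·) ht hs
  beta_reduce at hmul
  rw [mul_mul_mul_comm, hI] at hmul
  rw [hermiteCoeff_mul, hexp, div_mul_eq_mul_div ((-1 : ℂ) ^ k), hmul]
  push_cast
  linear_combination (-(1 : ℂ) / (2 * Real.pi) * (Complex.exp (-t ^ 2 / 2) *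
    Complex.exp (-s ^ 2 / 2)) * (1 / k.factorial * hermiteH k t * hermiteH k s)) * h1

lemma integrable_exp_mul_sq_gaussian {c : ℝ} (hc : c < 1 / 2) :
    Integrable (fun x : ℝ => Real.exp (c * x ^ 2)) (gaussianReal 0 1) := by
  rw [gaussianReal_of_var_ne_zero _ one_ne_zero, integrable_withDensity_iff_integrable_smul'
    (measurable_gaussianPDF _ _) (ae_of_all _ fun _ => gaussianPDF_lt_top)]
  have := (integrable_exp_neg_mul_sq (b := 1 / 2 - c) (by linarith)).const_mul (√(2 * Real.pi))⁻¹
  refine this.congr (ae_of_all _ fun x => ?_)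
  simp only [toReal_gaussianPDF, gaussianPDFReal, smul_eq_mul, NNReal.coe_one, mul_one, sub_zero]
  rw [mul_assoc, ← Real.exp_add]
  congr 2
  ring

lemma integrable_exp_abs_mul_gaussian {ρ : ℝ} (hρ : |ρ| < 1) :
    Integrable (fun p : ℝ × ℝ => Real.exp |ρ * p.1 * p.2|)
      ((gaussianReal 0 1).prod (gaussianReal 0 1)) := by
  have h := integrable_exp_mul_sq_gaussian (c := |ρ| / 2) (by linarith)
  refine (h.mul_prod h).mono' (by fun_prop) (ae_of_all _ fun p => ?_)
  rw [Real.norm_eq_abs, Real.abs_exp, ← Real.exp_add, Real.exp_le_exp, mul_assoc, abs_mul]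
  have : |p.1 * p.2| ≤ (p.1 ^ 2 + p.2 ^ 2) / 2 :=
    abs_le.2 ⟨by nlinarith [sq_nonneg (p.1 + p.2)], by nlinarith [sq_nonneg (p.1 - p.2)]⟩
  nlinarith [abs_nonneg ρ]

/-- The Gaussian integral behind Mehler's formula: Fourier inversion of the bivariate normal
characteristic function, written as an expectation over two independent variables. -/
lemma integral_cexp_bilinear_gaussian {ρ : ℝ} (hρ : |ρ| < 1) (t s : ℝ) :
    ∫ x : ℝ, ∫ y : ℝ, Complex.exp (-ρ * x * y) *
        (Complex.exp (t * x * Complex.I) * Complex.exp (s * y * Complex.I))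
        ∂gaussianReal 0 1 ∂gaussianReal 0 1
      = ((2 * Real.pi * bivariateNormalDensity t s ρ : ℝ) : ℂ) := by
  have h1 : 0 < 1 - ρ ^ 2 := by
    have := (sq_lt_one_iff_abs_lt_one ρ).2 hρ
    linarith
  have hinner : ∀ x : ℝ, ∫ y : ℝ, Complex.exp (-ρ * x * y) *
      (Complex.exp (t * x * Complex.I) * Complex.exp (s * y * Complex.I)) ∂gaussianReal 0 1
      = Complex.exp (t * x * Complex.I + (s * Complex.I - ρ * x) ^ 2 / 2) := by
    intro x
    have h2 := complexMGF_id_gaussianReal (μ := 0) (v := 1) (z := s * Complex.I - ρ * x)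
    rw [complexMGF] at h2
    rw [Complex.exp_add]
    have h3 : Complex.exp ((s * Complex.I - ρ * x) ^ 2 / 2)
        = ∫ y : ℝ, Complex.exp ((s * Complex.I - ρ * x) * (id y : ℝ)) ∂gaussianReal 0 1 := by
      rw [h2]; simp
    rw [h3, ← integral_const_mul]
    refine integral_congr_ae (ae_of_all _ fun y => ?_)
    simp only [← Complex.exp_add, id]
    congr 1
    ring
  simp_rw [hinner]
  rw [integral_gaussianReal_eq_integral_smul one_ne_zero]
  have hint : ∀ x : ℝ, gaussianPDFReal 0 1 x •
      Complex.exp (t * x * Complex.I + (s * Complex.I - ρ * x) ^ 2 / 2)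
      = ((√(2 * Real.pi))⁻¹ : ℝ) * Complex.exp ((-((1 - ρ ^ 2) / 2) : ℝ) * x ^ 2 +
        ((t - ρ * s : ℝ) * Complex.I) * x + (-s ^ 2 / 2 : ℝ)) := by
    intro x
    rw [gaussianPDFReal, Complex.real_smul, Complex.ofReal_mul, Complex.ofReal_exp, mul_assoc,
      ← Complex.exp_add]
    simp only [NNReal.coe_one, mul_one, sub_zero]
    congr 2
    push_cast
    ring_nf
    rw [Complex.I_sq]
    ring
  simp_rw [hint]
  rw [integral_const_mul, integral_cexp_quadratic
    (by rw [Complex.ofReal_re]; linarith)]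
  have hexp : ((-s ^ 2 / 2 : ℝ) : ℂ) - ((t - ρ * s : ℝ) * Complex.I) ^ 2 /
      (4 * (-((1 - ρ ^ 2) / 2) : ℝ))
      = ((-(t ^ 2 - 2 * ρ * t * s + s ^ 2) / (2 * (1 - ρ ^ 2)) : ℝ) : ℂ) := by
    rw [mul_pow, Complex.I_sq]
    norm_cast
    push_cast
    have : (1 : ℂ) - ρ ^ 2 ≠ 0 := by exact_mod_cast h1.ne'
    field_simp
    ring
  have hroot : ((Real.pi : ℂ) / -((-((1 - ρ ^ 2) / 2) : ℝ) : ℂ)) ^ (1 / 2 : ℂ)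
      = ((√(Real.pi / ((1 - ρ ^ 2) / 2)) : ℝ) : ℂ) := by
    rw [Real.sqrt_eq_rpow, Complex.ofReal_cpow (by positivity)]
    push_cast
    congr 1
    ring
  rw [hexp, hroot, ← Complex.ofReal_exp, ← Complex.ofReal_mul, ← Complex.ofReal_mul]
  congr 1
  rw [bivariateNormalDensity, ← mul_assoc, ← mul_assoc]
  congr 1
  rw [Real.sqrt_div' _ (by positivity), Real.sqrt_div h1.le, Real.sqrt_mul (by norm_num)]
  have ha : √Real.pi ≠ 0 := (Real.sqrt_pos.2 Real.pi_pos).ne'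
  have hb : √(1 - ρ ^ 2) ≠ 0 := (Real.sqrt_pos.2 h1).ne'
  have hc : √(2 : ℝ) ≠ 0 := by positivity
  field_simp

/-- **Mehler's formula.** -/
theorem hasSum_mehler {ρ : ℝ} (hρ : |ρ| < 1) (t s : ℝ) :
    HasSum (fun k => ρ ^ k * (hermiteCoeff t k * hermiteCoeff s k))
      (bivariateNormalDensity t s ρ) := by
  let γ := gaussianReal 0 1
  let e : ℝ × ℝ → ℂ := fun p => Complex.exp (t * p.1 * Complex.I) * Complex.exp (s * p.2 * Complex.I)
  have he : ∀ p, ‖e p‖ = 1 := fun p => by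
    simp only [e, norm_mul, ← Complex.ofReal_mul, Complex.norm_exp_ofReal_mul_I, mul_one]
  have hbound := integrable_exp_abs_mul_gaussian hρ
  -- Expand `e^{-ρxy}` and integrate termwise; `e^{|ρxy|}` is integrable because `|ρ| < 1`.
  have hsum : HasSum
      (fun k : ℕ => ∫ p : ℝ × ℝ, (-ρ * p.1 * p.2 : ℂ) ^ k / k.factorial * e p ∂(γ.prod γ))
      (∫ p : ℝ × ℝ, Complex.exp (-ρ * p.1 * p.2) * e p ∂(γ.prod γ)) := by
    refine hasSum_integral_of_dominated_convergence
      (fun k p => |ρ * p.1 * p.2| ^ k / k.factorial) (fun k => ?_)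
      (fun k => ae_of_all _ fun p => ?_) (ae_of_all _ fun p => ?_) ?_ (ae_of_all _ fun p => ?_)
    · exact Continuous.aestronglyMeasurable (by fun_prop)
    · rw [norm_mul, he, mul_one, norm_div, norm_pow]
      have : ‖(-ρ * p.1 * p.2 : ℂ)‖ = |ρ * p.1 * p.2| := by
        rw [← Complex.ofReal_neg, ← Complex.ofReal_mul, ← Complex.ofReal_mul, Complex.norm_real,
          Real.norm_eq_abs, neg_mul, neg_mul, abs_neg]
      rw [this, Complex.norm_natCast]
    · exact Real.summable_pow_div_factorial _
    · have : ∀ p : ℝ × ℝ, ∑' k : ℕ, |ρ * p.1 * p.2| ^ k / k.factorial = Real.exp |ρ * p.1 * p.2| :=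
        fun p => by rw [Real.exp_eq_exp_ℝ, NormedSpace.exp_eq_tsum_div]
      simp_rw [this]
      exact hbound
    · refine HasSum.mul_right _ ?_
      rw [Complex.exp_eq_exp_ℂ]
      exact NormedSpace.expSeries_div_hasSum_exp _
  have hint : Integrable (fun p : ℝ × ℝ => Complex.exp (-ρ * p.1 * p.2) * e p) (γ.prod γ) := by
    refine hbound.mono' (Continuous.aestronglyMeasurable (by fun_prop)) (ae_of_all _ fun p => ?_)
    rw [norm_mul, he, mul_one, Complex.norm_exp, Real.exp_le_exp]
    rw [← Complex.ofReal_neg, ← Complex.ofReal_mul, ← Complex.ofReal_mul, Complex.ofReal_re,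
      neg_mul, neg_mul]
    exact neg_le_abs _
  rw [integral_prod _ hint] at hsum
  rw [integral_cexp_bilinear_gaussian hρ t s] at hsum
  have hterm : ∀ k : ℕ, ∫ p : ℝ × ℝ, (-ρ * p.1 * p.2 : ℂ) ^ k / k.factorial * e p ∂(γ.prod γ)
      = ((2 * Real.pi * (ρ ^ k * (hermiteCoeff t k * hermiteCoeff s k)) : ℝ) : ℂ) := by
    intro k
    rw [Complex.ofReal_mul, Complex.ofReal_mul (ρ ^ k), ofReal_hermiteCoeff_mul, ← integral_prod_mul,
      ← integral_const_mul, ← integral_const_mul, ← integral_const_mul, ← integral_const_mul]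
    refine integral_congr_ae (ae_of_all _ fun p => ?_)
    have hpi : (Real.pi : ℂ) ≠ 0 := by exact_mod_cast Real.pi_ne_zero
    have hfac : (k.factorial : ℂ) ≠ 0 := by exact_mod_cast k.factorial_ne_zero
    simp only [e]
    push_cast
    rw [neg_mul, neg_mul, neg_pow, mul_pow, mul_pow]
    field_simp
  simp_rw [hterm] at hsum
  have h2 : (2 * Real.pi) ≠ 0 := by positivity
  exact (hasSum_mul_left_iff h2).1 (Complex.hasSum_ofReal.1 hsum)

/-- A bound on the diagonal and off the diagonal, uniform in the arguments. -/
lemma bivariateNormalDensity_le {ρ : ℝ} (hρ : |ρ| < 1) (t s : ℝ) :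
    0 ≤ bivariateNormalDensity t s ρ ∧ bivariateNormalDensity t s ρ ≤ (√(1 - ρ ^ 2))⁻¹ := by
  have h1 : 0 < 1 - ρ ^ 2 := by
    have := (sq_lt_one_iff_abs_lt_one ρ).2 hρ
    linarith
  have hs : 0 < √(1 - ρ ^ 2) := Real.sqrt_pos.2 h1
  refine ⟨by unfold bivariateNormalDensity; positivity, ?_⟩
  have hexp : Real.exp (-(t ^ 2 - 2 * ρ * t * s + s ^ 2) / (2 * (1 - ρ ^ 2))) ≤ 1 := by
    rw [Real.exp_le_one_iff]
    apply div_nonpos_of_nonpos_of_nonneg _ (by positivity)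
    nlinarith [sq_nonneg (t - ρ * s), sq_nonneg s, mul_nonneg (sq_nonneg s) h1.le]
  unfold bivariateNormalDensity
  calc _ ≤ 1 / (2 * Real.pi * √(1 - ρ ^ 2)) * 1 := by gcongr
    _ = (2 * Real.pi)⁻¹ * (√(1 - ρ ^ 2))⁻¹ := by rw [mul_one, one_div, mul_inv]
    _ ≤ 1 * (√(1 - ρ ^ 2))⁻¹ := by
      gcongr
      exact inv_le_one_of_one_le₀ (by linarith [Real.pi_gt_three])
    _ = _ := one_mul _

end Mehler

/-! ### Krawtchouk polynomials and a finite Mehler bound -/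

section Krawtchouk

/-- The generating polynomial `(1 - z)^v (1 + z)^(N - v)`. -/
def krawtPoly (N v : ℕ) : Polynomial ℝ :=
  (1 - Polynomial.X) ^ v * (1 + Polynomial.X) ^ (N - v)

lemma krawtchouk_eq (N k v : ℕ) : krawtchouk N k v = (krawtPoly N v).coeff k / N.choose k := rfl

lemma natDegree_krawtPoly_le {N v : ℕ} (hv : v ≤ N) : (krawtPoly N v).natDegree ≤ N := by
  have h1 : (1 - Polynomial.X : Polynomial ℝ).natDegree ≤ 1 :=
    (Polynomial.natDegree_sub_le _ _).trans (by simp)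
  have h2 : (1 + Polynomial.X : Polynomial ℝ).natDegree ≤ 1 :=
    (Polynomial.natDegree_add_le _ _).trans (by simp)
  calc (krawtPoly N v).natDegree ≤ v * 1 + (N - v) * 1 :=
        Polynomial.natDegree_mul_le.trans (add_le_add
          (Polynomial.natDegree_pow_le_of_le v h1) (Polynomial.natDegree_pow_le_of_le _ h2))
    _ = N := by omega

section Duality

open Polynomial

lemma coeff_coeff_swap (p : ℝ[X][X]) (i j : ℕ) :
    ((Bivariate.swap p).coeff i).coeff j = (p.coeff j).coeff i := by
  induction p using Polynomial.induction_on' with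
  | add p q hp hq => simp only [map_add, coeff_add, hp, hq]
  | monomial n f =>
    induction f using Polynomial.induction_on' with
    | add p q hp hq => simp only [map_add, coeff_add, hp, hq]
    | monomial m r =>
      rw [Bivariate.swap_monomial_monomial]
      simp only [coeff_monomial]
      by_cases h1 : m = i <;> by_cases h2 : n = j <;> simp [h1, h2, coeff_monomial]

/-- Self-duality `Q_k(v) = Q_v(k)` of the Krawtchouk polynomials: the bivariate generating function
`(1 + x + y - x y) ^ N` is symmetric. -/
lemma choose_mul_coeff_krawtPoly (N k v : ℕ) :
    (N.choose v : ℝ) * (krawtPoly N v).coeff k = N.choose k * (krawtPoly N k).coeff v := by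
  let F : ℝ[X][X] := X * C (1 - X) + C (1 + X)
  have hF : Bivariate.swap F = F := by
    simp only [F, map_add, map_mul, Bivariate.swap_Y, Bivariate.swap_C, Polynomial.map_X,
      map_sub, map_one]
    ring
  have hcoeff : ∀ u, (F ^ N).coeff u = N.choose u * krawtPoly N u := by
    intro u
    have : F ^ N = ∑ m ∈ Finset.range (N + 1),
        C (N.choose m * krawtPoly N m) * X ^ m := by
      rw [add_pow]
      refine Finset.sum_congr rfl fun m _ => ?_
      rw [mul_pow, krawtPoly, C_mul, C_mul, C_pow, C_pow, ← C_eq_natCast]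
      ring
    rw [this, finsetSum_coeff]
    simp only [coeff_C_mul_X_pow]
    rw [Finset.sum_ite_eq]
    split_ifs with h
    · rfl
    · rw [Nat.choose_eq_zero_of_lt (by simpa using h)]
      simp
  have h := coeff_coeff_swap (F ^ N) v k
  rw [map_pow, hF, hcoeff, hcoeff, ← C_eq_natCast, ← C_eq_natCast, coeff_C_mul, coeff_C_mul] at h
  exact h

/-- Homogenizing the generating polynomial. -/
lemma sum_coeff_krawtPoly_mul {R : Type*} [CommRing R] [Algebra ℝ R] (a b : R) (v w : ℕ) :
    ∑ k ∈ Finset.range (v + w + 1), algebraMap ℝ R ((krawtPoly (v + w) v).coeff k) *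
      (a ^ k * b ^ (v + w - k)) = (b - a) ^ v * (b + a) ^ w := by
  have step : ∀ (c : ℝ) (n : ℕ) (p : ℝ[X]), p.natDegree ≤ n →
      ∑ k ∈ Finset.range (n + 1 + 1), algebraMap ℝ R (((1 + C c * X) * p).coeff k) *
        (a ^ k * b ^ (n + 1 - k))
      = (b + algebraMap ℝ R c * a) * ∑ k ∈ Finset.range (n + 1), algebraMap ℝ R (p.coeff k) *
        (a ^ k * b ^ (n - k)) := by
    intro c n p hp
    have h1 : ∀ k, ((1 + C c * X) * p).coeff k = p.coeff k + c * (X * p).coeff k := fun k => by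
      rw [add_mul, one_mul, mul_assoc, coeff_add, coeff_C_mul]
    simp_rw [h1, map_add, map_mul, add_mul, Finset.sum_add_distrib]
    congr 1
    · rw [Finset.sum_range_succ, coeff_eq_zero_of_natDegree_lt (by omega), map_zero, zero_mul,
        add_zero, Finset.mul_sum]
      refine Finset.sum_congr rfl fun k hk => ?_
      rw [Nat.succ_sub (Nat.lt_succ_iff.1 (Finset.mem_range.1 hk)), pow_succ]
      ring
    · rw [Finset.sum_range_succ', coeff_X_mul_zero, map_zero, mul_zero, zero_mul, add_zero,
        Finset.mul_sum]
      refine Finset.sum_congr rfl fun k hk => ?_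
      rw [coeff_X_mul, Nat.add_sub_add_right, pow_succ]
      ring
  have hplus : ∀ w, ∑ k ∈ Finset.range (w + 1), algebraMap ℝ R (((1 + X : ℝ[X]) ^ w).coeff k) *
      (a ^ k * b ^ (w - k)) = (b + a) ^ w := by
    intro w
    induction w with
    | zero => simp
    | succ w ih =>
      have := step 1 w ((1 + X) ^ w) ((natDegree_pow_le_of_le w
        ((natDegree_add_le _ _).trans (by simp) : (1 + X : ℝ[X]).natDegree ≤ 1)).trans (by simp))
      rw [ih, C_1, one_mul, map_one, one_mul, ← pow_succ', ← pow_succ'] at this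
      exact this
  induction v with
  | zero => simpa [krawtPoly] using hplus w
  | succ v ih =>
    have := step (-1) (v + w) (krawtPoly (v + w) v) (natDegree_krawtPoly_le (by omega))
    rw [ih] at this
    have h2 : (1 + C (-1) * X) * krawtPoly (v + w) v = krawtPoly (v + 1 + w) (v + 1) := by
      rw [krawtPoly, krawtPoly, Nat.add_sub_cancel_left, Nat.add_sub_cancel_left]
      simp only [map_neg, map_one]
      ring
    rw [h2] at this
    rw [show v + 1 + w = v + w + 1 by omega] at this ⊢
    rw [this, map_neg, map_one]
    ring

/-- The finite Mehler kernel on the diagonal, as a coefficient of an explicit polynomial. -/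
lemma choose_mul_sum_sq_krawtPoly {N v : ℕ} (hv : v ≤ N) (ρ : ℝ) :
    (N.choose v : ℝ) * ∑ k ∈ Finset.range (N + 1), ρ ^ k * ((krawtPoly N v).coeff k ^ 2 / N.choose k)
      = ((C (1 - ρ) + C (1 + ρ) * X) ^ v * (C (1 + ρ) + C (1 - ρ) * X) ^ (N - v)).coeff v := by
  have h := sum_coeff_krawtPoly_mul (R := ℝ[X]) (C ρ * (1 - X)) (1 + X) v (N - v)
  rw [Nat.add_sub_cancel' hv] at h
  have e1 : (1 + X - C ρ * (1 - X) : ℝ[X]) = C (1 - ρ) + C (1 + ρ) * X := by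
    simp only [map_sub, map_add, map_one]; ring
  have e2 : (1 + X + C ρ * (1 - X) : ℝ[X]) = C (1 + ρ) + C (1 - ρ) * X := by
    simp only [map_sub, map_add, map_one]; ring
  rw [← e1, ← e2, ← h, finsetSum_coeff, Finset.mul_sum]
  refine Finset.sum_congr rfl fun k hk => ?_
  have hk' : k ≤ N := Nat.lt_succ_iff.1 (Finset.mem_range.1 hk)
  have hc : (N.choose k : ℝ) ≠ 0 := by exact_mod_cast (Nat.choose_pos hk').ne'
  have e3 : algebraMap ℝ ℝ[X] ((krawtPoly N v).coeff k) * ((C ρ * (1 - X)) ^ k * (1 + X) ^ (N - k))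
      = C ((krawtPoly N v).coeff k * ρ ^ k) * krawtPoly N k := by
    generalize (krawtPoly N v).coeff k = c
    rw [krawtPoly, algebraMap_eq, mul_pow, C_mul, C_pow]
    ring
  rw [e3, coeff_C_mul]
  have hd := choose_mul_coeff_krawtPoly N k v
  field_simp
  linear_combination (ρ ^ k * (krawtPoly N v).coeff k) * hd

end Duality

section FourierBound

open Polynomial

lemma integral_exp_int_mul_I (n : ℤ) :
    ∫ θ in (-Real.pi)..Real.pi, Complex.exp (n * θ * Complex.I) =
      if n = 0 then (2 * Real.pi : ℂ) else 0 := by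
  split_ifs with h
  · subst h
    simp
    ring
  · have hc : (n : ℂ) * Complex.I ≠ 0 := mul_ne_zero (by exact_mod_cast h) Complex.I_ne_zero
    have := integral_exp_mul_complex (a := -Real.pi) (b := Real.pi) hc
    simp_rw [mul_right_comm (n : ℂ) Complex.I] at this
    rw [this, div_eq_zero_iff]
    left
    rw [sub_eq_zero, Complex.exp_eq_exp_iff_exists_int]
    exact ⟨n, by push_cast; ring⟩

/-- Cauchy's formula for the coefficients of a polynomial. -/
lemma integral_eval_exp_mul (p : ℂ[X]) (v : ℕ) :
    ∫ θ in (-Real.pi)..Real.pi, p.eval (Complex.exp (θ * Complex.I)) *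
      Complex.exp (-(v * θ * Complex.I)) = 2 * Real.pi * p.coeff v := by
  simp_rw [eval_eq_sum_range, Finset.sum_mul]
  rw [intervalIntegral.integral_finsetSum fun i _ =>
    Continuous.intervalIntegrable (by fun_prop) _ _]
  have hterm : ∀ i : ℕ, ∫ θ in (-Real.pi)..Real.pi, p.coeff i * Complex.exp (θ * Complex.I) ^ i *
      Complex.exp (-(v * θ * Complex.I)) = if i = v then (2 * Real.pi : ℂ) * p.coeff v else 0 := by
    intro i
    have h1 : ∀ θ : ℝ, p.coeff i * Complex.exp (θ * Complex.I) ^ i *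
        Complex.exp (-(v * θ * Complex.I))
        = p.coeff i * Complex.exp (((i - v : ℤ) : ℂ) * θ * Complex.I) := by
      intro θ
      rw [← Complex.exp_nat_mul, mul_assoc, ← Complex.exp_add]
      congr 2
      push_cast
      ring
    simp_rw [h1]
    rw [intervalIntegral.integral_const_mul, integral_exp_int_mul_I]
    by_cases h : i = v
    · subst h; simp [mul_comm]
    · rw [if_neg h, if_neg (by omega), mul_zero]
  simp_rw [hterm]
  rw [Finset.sum_ite_eq']
  split_ifs with h
  · rfl
  · rw [coeff_eq_zero_of_natDegree_lt (by simpa using h), mul_zero]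

/-- On the unit circle the linear factors of the kernel have squared modulus
`4 - 2 (1 - ρ²) (1 - cos θ)`, which decays like a Gaussian in `θ`. -/
lemma norm_sub_add_exp_le (ρ : ℝ) (hρ : |ρ| ≤ 1) {θ : ℝ} (hθ : |θ| ≤ Real.pi) :
    ‖((1 - ρ : ℝ) : ℂ) + ((1 + ρ : ℝ) : ℂ) * Complex.exp (θ * Complex.I)‖
      ≤ 2 * Real.exp (-((1 - ρ ^ 2) / (2 * Real.pi ^ 2)) * θ ^ 2) := by
  have h1 : 0 ≤ 1 - ρ ^ 2 := by
    have := (sq_le_one_iff_abs_le_one ρ).2 hρ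
    linarith
  have hcos := Real.cos_le_one_sub_mul_cos_sq hθ
  rw [← abs_of_nonneg (norm_nonneg _), ← abs_of_nonneg (show
    0 ≤ 2 * Real.exp (-((1 - ρ ^ 2) / (2 * Real.pi ^ 2)) * θ ^ 2) by positivity), ← sq_le_sq,
    mul_pow, ← Real.exp_nat_mul, Complex.exp_mul_I, ← Complex.normSq_eq_norm_sq,
    ← Complex.ofReal_cos, ← Complex.ofReal_sin, Complex.normSq_apply]
  simp only [Complex.add_re, Complex.add_im, Complex.mul_re, Complex.mul_im, Complex.ofReal_re,
    Complex.ofReal_im, Complex.I_re, Complex.I_im]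
  have hpi := Real.pi_pos
  have hexp := Real.add_one_le_exp (((2 : ℕ) : ℝ) * (-((1 - ρ ^ 2) / (2 * Real.pi ^ 2)) * θ ^ 2))
  have e1 : ((2 : ℕ) : ℝ) * (-((1 - ρ ^ 2) / (2 * Real.pi ^ 2)) * θ ^ 2)
      = -((1 - ρ ^ 2) * (θ ^ 2 / Real.pi ^ 2)) := by
    push_cast
    field_simp
  rw [e1] at hexp ⊢
  have e2 : 2 / Real.pi ^ 2 * θ ^ 2 = 2 * (θ ^ 2 / Real.pi ^ 2) := by ring
  rw [e2] at hcos
  have hsc := Real.sin_sq_add_cos_sq θ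
  have hmul := mul_le_mul_of_nonneg_left hcos h1
  rw [show ∀ c s : ℝ, (1 - ρ + ((1 + ρ) * (c + (s * 0 - 0 * 1)) - 0 * (0 + (s * 1 + 0 * 0)))) *
        (1 - ρ + ((1 + ρ) * (c + (s * 0 - 0 * 1)) - 0 * (0 + (s * 1 + 0 * 0)))) +
      (0 + ((1 + ρ) * (0 + (s * 1 + 0 * 0)) + 0 * (c + (s * 0 - 0 * 1)))) *
        (0 + ((1 + ρ) * (0 + (s * 1 + 0 * 0)) + 0 * (c + (s * 0 - 0 * 1))))
      = (1 - ρ) ^ 2 + (1 + ρ) ^ 2 * (s ^ 2 + c ^ 2) + 2 * ((1 - ρ ^ 2) * c) from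
    fun c s => by ring, hsc]
  linarith

/-- Cauchy's formula with the Gaussian bound for each of the `N` factors. -/
lemma coeff_le_of_fourier {N v : ℕ} (hv : v ≤ N) (hN : 0 < N) {ρ : ℝ} (hρ : |ρ| < 1) :
    ((C (1 - ρ) + C (1 + ρ) * X) ^ v * (C (1 + ρ) + C (1 - ρ) * X) ^ (N - v) : ℝ[X]).coeff v
      ≤ 2 * 2 ^ N / √(N * (1 - ρ ^ 2)) := by
  have h1 : 0 < 1 - ρ ^ 2 := by
    have := (sq_lt_one_iff_abs_lt_one ρ).2 hρ
    linarith
  have hpi := Real.pi_pos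
  have hN' : (0 : ℝ) < N := by exact_mod_cast hN
  set f : ℝ[X] := (C (1 - ρ) + C (1 + ρ) * X) ^ v * (C (1 + ρ) + C (1 - ρ) * X) ^ (N - v) with hf
  let b : ℝ := N * ((1 - ρ ^ 2) / (2 * Real.pi ^ 2))
  have hb : 0 < b := by positivity
  have hF := integral_eval_exp_mul (f.map (algebraMap ℝ ℂ)) v
  have hbound : ∀ θ ∈ Set.Ioc (-Real.pi) Real.pi,
      ‖(f.map (algebraMap ℝ ℂ)).eval (Complex.exp (θ * Complex.I)) *
        Complex.exp (-(v * θ * Complex.I))‖ ≤ 2 ^ N * Real.exp (-b * θ ^ 2) := by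
    intro θ hθ
    have hθ' : |θ| ≤ Real.pi := abs_le.2 ⟨hθ.1.le, hθ.2⟩
    have hu : ‖Complex.exp (-(v * θ * Complex.I))‖ = 1 := by
      have : (-(v * θ * Complex.I) : ℂ) = ((-(v * θ) : ℝ) : ℂ) * Complex.I := by push_cast; ring
      rw [this, Complex.norm_exp_ofReal_mul_I]
    have ha := norm_sub_add_exp_le ρ hρ.le hθ'
    have hb' := norm_sub_add_exp_le (-ρ) (by rw [abs_neg]; exact hρ.le) hθ'
    rw [sub_neg_eq_add, ← sub_eq_add_neg, neg_sq] at hb'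
    rw [norm_mul, hu, mul_one, hf]
    simp only [Polynomial.map_mul, Polynomial.map_pow, Polynomial.map_add, map_C, map_X, eval_mul,
      eval_pow, eval_add, eval_C, eval_X, norm_mul, norm_pow, Complex.coe_algebraMap]
    calc _ ≤ (2 * Real.exp (-((1 - ρ ^ 2) / (2 * Real.pi ^ 2)) * θ ^ 2)) ^ v *
          (2 * Real.exp (-((1 - ρ ^ 2) / (2 * Real.pi ^ 2)) * θ ^ 2)) ^ (N - v) := by
          gcongr
      _ = 2 ^ N * Real.exp (-b * θ ^ 2) := by
          rw [← pow_add, Nat.add_sub_cancel' hv, mul_pow, ← Real.exp_nat_mul]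
          congr 2
          simp only [b]
          ring
  have hle : ‖∫ θ in (-Real.pi)..Real.pi, (f.map (algebraMap ℝ ℂ)).eval
      (Complex.exp (θ * Complex.I)) * Complex.exp (-(v * θ * Complex.I))‖
      ≤ 2 ^ N * √(Real.pi / b) := by
    have hi : Integrable fun θ : ℝ => 2 ^ N * Real.exp (-b * θ ^ 2) :=
      (integrable_exp_neg_mul_sq hb).const_mul _
    rw [← integral_gaussian, ← integral_const_mul]
    rw [intervalIntegral.integral_of_le (by linarith)]
    calc _ ≤ ∫ θ in Set.Ioc (-Real.pi) Real.pi, 2 ^ N * Real.exp (-b * θ ^ 2) :=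
          norm_integral_le_of_norm_le hi.integrableOn
            ((ae_restrict_iff' measurableSet_Ioc).2 (ae_of_all _ hbound))
      _ ≤ _ := setIntegral_le_integral hi (ae_of_all _ fun θ => by positivity)
  rw [hF, coeff_map, Complex.coe_algebraMap, norm_mul, norm_mul, Complex.norm_real,
    Complex.norm_real, Complex.norm_ofNat, Real.norm_eq_abs, Real.norm_eq_abs, abs_of_pos hpi] at hle
  have hcoeff : f.coeff v ≤ 2 ^ N * √(Real.pi / b) / (2 * Real.pi) := by
    rw [le_div_iff₀ (by positivity), mul_comm]
    exact (mul_le_mul_of_nonneg_left (le_abs_self _) (by positivity)).trans hle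
  refine hcoeff.trans ?_
  have e1 : Real.pi / b = (2 * Real.pi ^ 3) / (N * (1 - ρ ^ 2)) := by
    simp only [b]
    field_simp
  rw [e1, Real.sqrt_div (by positivity), mul_div_assoc', div_div, mul_comm (√_), ← div_div]
  gcongr
  rw [div_le_iff₀ (by positivity)]
  have hs : √(2 * Real.pi ^ 3) ≤ 4 * Real.pi := by
    rw [Real.sqrt_le_left (by positivity)]
    nlinarith [Real.pi_lt_four, sq_nonneg Real.pi, pow_pos hpi 2]
  nlinarith [pow_pos (two_pos : (0 : ℝ) < 2) N]

/-- The case `ρ = 0` of `coeff_le_of_fourier`. -/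
lemma choose_le_div_sqrt {N v : ℕ} (hv : v ≤ N) (hN : 0 < N) :
    (N.choose v : ℝ) ≤ 2 * 2 ^ N / √N := by
  have := coeff_le_of_fourier hv hN (ρ := 0) (by simp)
  simp only [sub_zero, add_zero, map_one, one_mul, ← pow_add, Nat.add_sub_cancel' hv] at this
  rw [coeff_one_add_X_pow] at this
  simpa using this

end FourierBound

/-- The coefficient of `m_k ζ_k` in the rescaled level set sum at level `v`. -/
def levelCoeff (N v k : ℕ) : ℝ :=
  1 / 2 * √((N : ℝ) / 2 ^ N) * ((N.choose v : ℝ) * (1 / (2 : ℝ) ^ ((N : ℝ) / 2))) *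
    (√(N.choose k : ℝ) * krawtchouk N k v)

/-- The factor of `levelCoeff` that does not depend on `k`, a rescaled binomial probability. -/
def levelWeight (N v : ℕ) : ℝ := 1 / 2 * √N * (N.choose v / 2 ^ N)

lemma levelCoeff_eq (N v k : ℕ) :
    levelCoeff N v k = levelWeight N v * ((krawtPoly N v).coeff k / √(N.choose k)) := by
  have h2 : √((2 : ℝ) ^ N) = (2 : ℝ) ^ ((N : ℝ) / 2) := by
    rw [Real.sqrt_eq_rpow, ← Real.rpow_natCast, ← Real.rpow_mul (by norm_num)]
    congr 1
    ring
  have h3 : (2 : ℝ) ^ N = (2 : ℝ) ^ ((N : ℝ) / 2) * (2 : ℝ) ^ ((N : ℝ) / 2) := by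
    rw [← h2, Real.mul_self_sqrt (by positivity)]
  have hpos : (0 : ℝ) < (2 : ℝ) ^ ((N : ℝ) / 2) := by positivity
  rw [levelCoeff, levelWeight, krawtchouk_eq, Real.sqrt_div (by positivity), h2]
  have h4 : √(N.choose k : ℝ) * ((krawtPoly N v).coeff k / (N.choose k : ℝ))
      = (krawtPoly N v).coeff k / √(N.choose k) := by
    rcases eq_or_ne (N.choose k : ℝ) 0 with h | h
    · simp [h]
    · have : 0 < (N.choose k : ℝ) := lt_of_le_of_ne (by positivity) h.symm
      have hs : 0 < √(N.choose k : ℝ) := Real.sqrt_pos.2 this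
      conv_lhs => rw [← Real.mul_self_sqrt this.le]
      rw [Real.sqrt_mul_self (by positivity)]
      field_simp
  rw [h4, h3]
  field_simp

lemma levelCoeff_eq_zero {N k : ℕ} (h : N < k) (v : ℕ) : levelCoeff N v k = 0 := by
  rw [levelCoeff_eq, Nat.choose_eq_zero_of_lt h]
  simp

lemma levelCoeff_eq_zero_of_lt {N v : ℕ} (h : N < v) (k : ℕ) : levelCoeff N v k = 0 := by
  rw [levelCoeff, Nat.choose_eq_zero_of_lt h]
  simp

/-- The squared coefficients satisfy, uniformly in `N` and the level, the bound that Mehler's formula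
gives for the limit. -/
theorem sum_pow_mul_sq_levelCoeff_le (N v : ℕ) {ρ : ℝ} (hρ : |ρ| < 1) :
    ∑ k ∈ Finset.range (N + 1), ρ ^ k * levelCoeff N v k ^ 2 ≤ (√(1 - ρ ^ 2))⁻¹ := by
  have h1 : 0 < 1 - ρ ^ 2 := by
    have := (sq_lt_one_iff_abs_lt_one ρ).2 hρ
    linarith
  rcases lt_or_ge N v with hv | hv
  · simp only [levelCoeff_eq_zero_of_lt hv]
    simp
  rcases Nat.eq_zero_or_pos N with rfl | hN
  · simp [levelCoeff]
  have hN' : (0 : ℝ) < N := by exact_mod_cast hN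
  have hterm : ∑ k ∈ Finset.range (N + 1), ρ ^ k * levelCoeff N v k ^ 2
      = levelWeight N v ^ 2 * ∑ k ∈ Finset.range (N + 1),
        ρ ^ k * ((krawtPoly N v).coeff k ^ 2 / N.choose k) := by
    rw [Finset.mul_sum]
    refine Finset.sum_congr rfl fun k _ => ?_
    rw [levelCoeff_eq, mul_pow, div_pow, Real.sq_sqrt (by positivity)]
    ring
  have hid := choose_mul_sum_sq_krawtPoly hv ρ
  have hc1 := coeff_le_of_fourier hv hN hρ
  rw [← hid] at hc1
  have hc2 := choose_le_div_sqrt hv hN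
  have hsN : 0 < √(N : ℝ) := Real.sqrt_pos.2 hN'
  have hs1 : 0 < √(1 - ρ ^ 2) := Real.sqrt_pos.2 h1
  rw [Real.sqrt_mul hN'.le] at hc1
  set T := ∑ k ∈ Finset.range (N + 1), ρ ^ k * ((krawtPoly N v).coeff k ^ 2 / N.choose k)
  have hchoose : (0 : ℝ) < N.choose v := by exact_mod_cast Nat.choose_pos hv
  have h2N : (0 : ℝ) < 2 ^ N := by positivity
  -- One factor `choose N v` completes the kernel to the coefficient bounded above, the other one is
  -- at most of order `2 ^ N / √N`.
  calc _ = levelWeight N v ^ 2 * T := hterm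
    _ = (√N ^ 2 / (4 * (2 ^ N) ^ 2)) * N.choose v * (N.choose v * T) := by
      rw [levelWeight]; ring
    _ ≤ (√N ^ 2 / (4 * (2 ^ N) ^ 2)) * N.choose v * (2 * 2 ^ N / (√N * √(1 - ρ ^ 2))) := by
      gcongr
    _ ≤ (√N ^ 2 / (4 * (2 ^ N) ^ 2)) * (2 * 2 ^ N / √N) * (2 * 2 ^ N / (√N * √(1 - ρ ^ 2))) := by
      gcongr
    _ = (√(1 - ρ ^ 2))⁻¹ := by
      field_simp
      norm_num

end Krawtchouk

/-! ### The limit near the middle level -/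

section HermiteLimit

open Polynomial in
lemma derivative_hermite_succ (k : ℕ) :
    derivative (hermite (k + 1)) = (k + 1 : ℤ[X]) * hermite k := by
  induction k with
  | zero => simp
  | succ k ih =>
    rw [hermite_succ (k + 1), derivative_sub, derivative_mul, derivative_X, one_mul, ih,
      derivative_mul]
    have h1 : derivative ((k : ℤ[X]) + 1) = 0 := by simp
    rw [h1, hermite_succ k]
    push_cast
    ring

lemma hermiteH_add_two (k : ℕ) (t : ℝ) :
    hermiteH (k + 2) t = t * hermiteH (k + 1) t - (k + 1) * hermiteH k t := by
  rw [hermiteH_succ, derivative_hermite_succ]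
  simp [hermiteH]

section Recurrence

open Polynomial

/-- The first order differential equation of the generating polynomial. -/
lemma derivative_krawtPoly {N v : ℕ} (hv : v ≤ N) :
    (1 - X ^ 2) * derivative (krawtPoly N v) = (C ((N : ℝ) - 2 * v) - C (N : ℝ) * X) * krawtPoly N v := by
  have h1 : ∀ n : ℕ, (1 - X) * derivative ((1 - X : ℝ[X]) ^ n) = -C (n : ℝ) * (1 - X) ^ n := by
    rintro (_ | n)
    · simp
    · rw [derivative_pow, Nat.add_sub_cancel]
      simp only [derivative_sub, derivative_one, derivative_X]
      ring
  have h2 : ∀ n : ℕ, (1 + X) * derivative ((1 + X : ℝ[X]) ^ n) = C (n : ℝ) * (1 + X) ^ n := by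
    rintro (_ | n)
    · simp
    · rw [derivative_pow, Nat.add_sub_cancel]
      simp only [derivative_add, derivative_one, derivative_X]
      ring
  have h3 : C (N : ℝ) = C (v : ℝ) + C ((N - v : ℕ) : ℝ) := by
    rw [← C_add, Nat.cast_sub hv, add_sub_cancel]
  rw [krawtPoly, derivative_mul, C_sub, C_mul, h3, show (C (2 : ℝ)) = 2 from rfl]
  linear_combination ((1 + X) * (1 + X) ^ (N - v)) * h1 v + ((1 - X) * (1 - X) ^ v) * h2 (N - v)

lemma coeff_zero_krawtPoly (N v : ℕ) : (krawtPoly N v).coeff 0 = 1 := by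
  simp [krawtPoly, coeff_zero_eq_eval_zero]

lemma coeff_one_krawtPoly {N v : ℕ} (hv : v ≤ N) : (krawtPoly N v).coeff 1 = N - 2 * v := by
  have h := congrArg (fun p => coeff p 0) (derivative_krawtPoly hv)
  simp only [sub_mul, one_mul, coeff_sub, coeff_derivative, coeff_C_mul, mul_assoc] at h
  rw [pow_two, mul_assoc, coeff_X_mul_zero, coeff_X_mul_zero, coeff_zero_krawtPoly] at h
  simpa using h

/-- The three-term recurrence in the degree. -/
lemma coeff_add_two_krawtPoly {N v : ℕ} (hv : v ≤ N) (k : ℕ) :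
    (k + 2) * (krawtPoly N v).coeff (k + 2)
      = (N - 2 * v) * (krawtPoly N v).coeff (k + 1) - (N - k) * (krawtPoly N v).coeff k := by
  have h := congrArg (fun p => coeff p (k + 1)) (derivative_krawtPoly hv)
  simp only [sub_mul, one_mul, coeff_sub, coeff_derivative, coeff_C_mul, mul_assoc] at h
  rw [coeff_X_mul] at h
  rcases k with _ | k
  · rw [pow_two, mul_assoc, coeff_X_mul, coeff_X_mul_zero] at h
    push_cast at h ⊢
    linear_combination h
  · rw [coeff_X_pow_mul, coeff_derivative] at h
    push_cast at h ⊢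
    linear_combination h

end Recurrence

variable {v : ℕ → ℕ} {t : ℝ}

/-- The Krawtchouk polynomials near the middle level tend to Hermite polynomials: the two satisfy
the same recurrence in the limit. -/
lemma tendsto_coeff_krawtPoly (hv : ∀ᶠ N in atTop, v N ≤ N)
    (ht : Tendsto (fun N : ℕ => ((N : ℝ) - 2 * v N) / √N) atTop (𝓝 (-t))) (k : ℕ) :
    Tendsto (fun N : ℕ => (krawtPoly N (v N)).coeff k / √N ^ k) atTop
      (𝓝 ((-1) ^ k * hermiteH k t / k.factorial)) := by
  suffices h : ∀ k, Tendsto (fun N : ℕ => (krawtPoly N (v N)).coeff k / √N ^ k) atTop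
      (𝓝 ((-1) ^ k * hermiteH k t / k.factorial)) ∧
      Tendsto (fun N : ℕ => (krawtPoly N (v N)).coeff (k + 1) / √N ^ (k + 1)) atTop
      (𝓝 ((-1) ^ (k + 1) * hermiteH (k + 1) t / (k + 1).factorial)) from (h k).1
  intro k
  induction k with
  | zero =>
    constructor
    · simp [coeff_zero_krawtPoly, hermiteH]
    · have : (-1) ^ (0 + 1) * hermiteH (0 + 1) t / (0 + 1).factorial = -t := by simp [hermiteH]
      rw [this]
      refine ht.congr' ?_
      filter_upwards [hv] with N hN
      rw [zero_add, coeff_one_krawtPoly hN, pow_one]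
  | succ k ih =>
    refine ⟨ih.2, ?_⟩
    have hk : Tendsto (fun N : ℕ => ((N : ℝ) - k) / N) atTop (𝓝 1) := by
      have h0 : Tendsto (fun N : ℕ => 1 - (k : ℝ) / N) atTop (𝓝 (1 - 0)) :=
        tendsto_const_nhds.sub (tendsto_const_div_atTop_nhds_zero_nat _)
      rw [sub_zero] at h0
      refine h0.congr' ?_
      filter_upwards [eventually_gt_atTop 0] with N hN
      have : (N : ℝ) ≠ 0 := by exact_mod_cast hN.ne'
      field_simp
    have h := ((ht.mul ih.2).sub (hk.mul ih.1)).div_const ((k : ℝ) + 2)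
    have hlim : (-t * ((-1) ^ (k + 1) * hermiteH (k + 1) t / (k + 1).factorial) -
        1 * ((-1) ^ k * hermiteH k t / k.factorial)) / ((k : ℝ) + 2)
        = (-1) ^ (k + 1 + 1) * hermiteH (k + 1 + 1) t / (k + 1 + 1).factorial := by
      rw [show k + 1 + 1 = k + 2 from rfl, hermiteH_add_two, Nat.factorial_succ (k + 1),
        Nat.factorial_succ k]
      have h1 : (k.factorial : ℝ) ≠ 0 := by exact_mod_cast k.factorial_ne_zero
      have h2 : (k : ℝ) + 1 ≠ 0 := by positivity
      have h3 : (k : ℝ) + 2 ≠ 0 := by positivity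
      push_cast
      rw [show (k : ℝ) + 1 + 1 = k + 2 by ring]
      field_simp
      ring
    rw [← hlim]
    refine h.congr' ?_
    filter_upwards [hv, eventually_gt_atTop 0] with N hN hN0
    have hN1 : (0 : ℝ) < N := by exact_mod_cast hN0
    have hs : √(N : ℝ) ≠ 0 := (Real.sqrt_pos.2 hN1).ne'
    have hrec := coeff_add_two_krawtPoly hN k
    have h3 : (k : ℝ) + 2 ≠ 0 := by positivity
    have hsq : (N : ℝ) = √N ^ 2 := (Real.sq_sqrt hN1.le).symm
    rw [div_eq_iff h3, show k + 1 + 1 = k + 2 from rfl]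
    rw [show ((N : ℝ) - k) / N = (N - k) / √N ^ 2 by rw [← hsq], div_mul_div_comm, div_mul_div_comm,
      ← pow_add, ← pow_succ', add_comm 2 k, ← sub_div, ← hrec]
    ring

end HermiteLimit

section LocalLimit

lemma abs_cos_pow_le (N : ℕ) {x : ℝ} (hx : |x| ≤ Real.pi / 2) :
    |Real.cos x ^ N| ≤ Real.exp (-(2 / Real.pi ^ 2) * x ^ 2 * N) := by
  have h0 : 0 ≤ Real.cos x := Real.cos_nonneg_of_mem_Icc (Set.mem_Icc.2 (abs_le.1 hx))
  have h1 := Real.cos_le_one_sub_mul_cos_sq (hx.trans (by linarith [Real.pi_pos]))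
  have h2 := Real.add_one_le_exp (-(2 / Real.pi ^ 2) * x ^ 2)
  rw [abs_pow, abs_of_nonneg h0, mul_comm _ (N : ℝ), Real.exp_nat_mul]
  gcongr
  linarith

lemma tendsto_cos_div_sqrt_pow (x : ℝ) :
    Tendsto (fun N : ℕ => Real.cos (x / √N) ^ N) atTop (𝓝 (Real.exp (-x ^ 2 / 2))) := by
  have h : Tendsto (fun N : ℕ => (N : ℝ) * (Real.cos (x / √N) - 1)) atTop (𝓝 (-x ^ 2 / 2)) := by
    have herr : Tendsto (fun N : ℕ => x ^ 4 * (5 / 96) / N) atTop (𝓝 0) :=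
      tendsto_const_div_atTop_nhds_zero_nat _
    rw [tendsto_iff_norm_sub_tendsto_zero]
    refine squeeze_zero' (Eventually.of_forall fun N => norm_nonneg _) ?_ herr
    have hev : ∀ᶠ N : ℕ in atTop, x ^ 2 ≤ N := by
      filter_upwards [eventually_ge_atTop ⌈x ^ 2⌉₊] with N hN using Nat.ceil_le.1 hN
    filter_upwards [hev, eventually_gt_atTop 0] with N hN hN0
    have hN1 : (0 : ℝ) < N := by exact_mod_cast hN0
    have hs : 0 < √(N : ℝ) := Real.sqrt_pos.2 hN1
    have hsq : √(N : ℝ) ^ 2 = N := Real.sq_sqrt hN1.le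
    have hx : |x / √N| ≤ 1 := by
      rw [← sq_le_one_iff_abs_le_one, div_pow, hsq, div_le_one hN1]
      exact hN
    have hb := Real.cos_bound hx
    have e1 : (x / √N) ^ 2 = x ^ 2 / N := by rw [div_pow, hsq]
    have e2 : |x / √N| ^ 4 = x ^ 4 / N ^ 2 := by
      rw [← abs_pow, abs_of_nonneg (by positivity), div_pow,
        show √(N : ℝ) ^ 4 = (√(N : ℝ) ^ 2) ^ 2 by ring, hsq]
    rw [e1, e2] at hb
    have e3 : (N : ℝ) * (Real.cos (x / √N) - 1) - -x ^ 2 / 2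
        = N * (Real.cos (x / √N) - (1 - x ^ 2 / N / 2)) := by
      field_simp
      ring
    rw [e3, norm_mul, Real.norm_eq_abs, Real.norm_eq_abs, abs_of_pos hN1]
    calc _ ≤ (N : ℝ) * (x ^ 4 / N ^ 2 * (5 / 96)) := by gcongr
      _ = x ^ 4 * (5 / 96) / N := by field_simp
  have := Real.tendsto_one_add_pow_exp_of_tendsto h
  simpa using this

/-- The binomial coefficient as a Fourier coefficient of `(1 + e^{iθ}) ^ N`, with the phase pulled out
of `1 + e^{iθ} = 2 cos (θ/2) e^{iθ/2}`. -/
lemma choose_eq_integral (N v : ℕ) :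
    ∫ θ in (-Real.pi)..Real.pi, ((Real.cos (θ / 2) ^ N : ℝ) : ℂ) *
        Complex.exp (((N : ℝ) - 2 * v : ℝ) * (θ / 2 : ℝ) * Complex.I)
      = 2 * Real.pi * (N.choose v / 2 ^ N) := by
  have h := integral_eval_exp_mul ((1 + Polynomial.X) ^ N) v
  rw [Polynomial.coeff_one_add_X_pow] at h
  rw [mul_div_assoc', eq_div_iff (pow_ne_zero _ two_ne_zero), ← h, mul_comm, ← intervalIntegral.integral_const_mul]
  refine intervalIntegral.integral_congr fun θ _ => ?_
  have hc := Complex.two_cos ((θ / 2 : ℝ) : ℂ)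
  have h1 : (1 : ℂ) + Complex.exp (θ * Complex.I)
      = 2 * Complex.cos ((θ / 2 : ℝ) : ℂ) * Complex.exp ((θ / 2 : ℝ) * Complex.I) := by
    rw [hc, add_mul, ← Complex.exp_add, ← Complex.exp_add, add_comm]
    congr 1
    · congr 1; push_cast; ring
    · rw [neg_mul, neg_add_cancel, Complex.exp_zero]
  simp only [Polynomial.eval_pow, Polynomial.eval_add, Polynomial.eval_one, Polynomial.eval_X]
  rw [h1, mul_pow, mul_pow, ← Complex.exp_nat_mul, Complex.ofReal_pow, Complex.ofReal_cos,
    mul_assoc (_ * _), ← Complex.exp_add, ← mul_assoc]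
  congr 2
  push_cast
  ring

lemma levelWeight_eq_integral {N : ℕ} (hN : 0 < N) (v : ℕ) :
    ((levelWeight N v : ℝ) : ℂ) = 1 / (2 * Real.pi) *
      ∫ x : ℝ, (Set.Ioc (-(Real.pi * √N / 2)) (Real.pi * √N / 2)).indicator (fun x : ℝ =>
        ((Real.cos (x / √N) ^ N : ℝ) : ℂ) *
          Complex.exp ((((N : ℝ) - 2 * v) / √N : ℝ) * x * Complex.I)) x := by
  have hN1 : (0 : ℝ) < N := by exact_mod_cast hN
  have hs : 0 < √(N : ℝ) := Real.sqrt_pos.2 hN1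
  have hpi := Real.pi_pos
  have h := choose_eq_integral N v
  have hsub := intervalIntegral.integral_comp_div (a := -(Real.pi * √N / 2)) (b := Real.pi * √N / 2)
    (fun θ : ℝ => ((Real.cos (θ / 2) ^ N : ℝ) : ℂ) *
        Complex.exp (((N : ℝ) - 2 * v : ℝ) * (θ / 2 : ℝ) * Complex.I)) (c := √N / 2) (by positivity)
  have e1 : Real.pi * √N / 2 / (√N / 2) = Real.pi := by field_simp
  rw [neg_div, e1, h, intervalIntegral.integral_of_le (by
    have : 0 < Real.pi * √N / 2 := by positivity
    linarith), ← integral_indicator measurableSet_Ioc] at hsub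
  have hint : ∀ x : ℝ, ((Real.cos (x / (√N / 2) / 2) ^ N : ℝ) : ℂ) *
        Complex.exp (((N : ℝ) - 2 * v : ℝ) * (x / (√N / 2) / 2 : ℝ) * Complex.I)
      = ((Real.cos (x / √N) ^ N : ℝ) : ℂ) *
          Complex.exp ((((N : ℝ) - 2 * v) / √N : ℝ) * x * Complex.I) := by
    intro x
    have : x / (√N / 2) / 2 = x / √N := by field_simp
    rw [this]
    congr 3
    push_cast
    ring
  simp_rw [hint] at hsub
  rw [hsub, Complex.real_smul, levelWeight]
  have : (Real.pi : ℂ) ≠ 0 := by exact_mod_cast hpi.ne'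
  push_cast
  field_simp

variable {v : ℕ → ℕ} {t : ℝ}

/-- The local de Moivre-Laplace theorem. -/
theorem tendsto_levelWeight
    (ht : Tendsto (fun N : ℕ => ((N : ℝ) - 2 * v N) / √N) atTop (𝓝 (-t))) :
    Tendsto (fun N => levelWeight N (v N)) atTop
      (𝓝 (1 / √(2 * Real.pi) * Real.exp (-t ^ 2 / 2))) := by
  have hpi := Real.pi_pos
  let f : ℕ → ℝ → ℂ := fun N x => (Set.Ioc (-(Real.pi * √N / 2)) (Real.pi * √N / 2)).indicator
    (fun x : ℝ => ((Real.cos (x / √N) ^ N : ℝ) : ℂ) *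
          Complex.exp ((((N : ℝ) - 2 * v N) / √N : ℝ) * x * Complex.I)) x
  have hlim : Tendsto (fun N => ∫ x, f N x) atTop
      (𝓝 (∫ x : ℝ, ((Real.exp (-x ^ 2 / 2) : ℝ) : ℂ) * Complex.exp ((-t : ℝ) * x * Complex.I))) := by
    refine tendsto_integral_filter_of_dominated_convergence
      (fun x => Real.exp (-(2 / Real.pi ^ 2) * x ^ 2)) ?_ ?_
      (integrable_exp_neg_mul_sq (by positivity)) (ae_of_all _ fun x => ?_)
    · refine Eventually.of_forall fun N => ?_
      refine AEStronglyMeasurable.indicator (Continuous.aestronglyMeasurable ?_) measurableSet_Ioc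
      fun_prop
    · filter_upwards [eventually_gt_atTop 0] with N hN
      refine ae_of_all _ fun x => ?_
      have hN1 : (0 : ℝ) < N := by exact_mod_cast hN
      have hs : 0 < √(N : ℝ) := Real.sqrt_pos.2 hN1
      simp only [f]
      by_cases hx : x ∈ Set.Ioc (-(Real.pi * √N / 2)) (Real.pi * √N / 2)
      · rw [Set.indicator_of_mem hx, norm_mul, ← Complex.ofReal_mul, Complex.norm_exp_ofReal_mul_I,
          mul_one, Complex.norm_real, Real.norm_eq_abs]
        have hx' : |x / √N| ≤ Real.pi / 2 := by
          rw [abs_div, abs_of_pos hs, div_le_iff₀ hs, abs_le]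
          exact ⟨by linarith [hx.1], by linarith [hx.2]⟩
        refine (abs_cos_pow_le N hx').trans (le_of_eq ?_)
        rw [div_pow, Real.sq_sqrt hN1.le]
        congr 1
        field_simp
      · rw [Set.indicator_of_notMem hx, norm_zero]
        positivity
    · have hev : ∀ᶠ N : ℕ in atTop, x ∈ Set.Ioc (-(Real.pi * √N / 2)) (Real.pi * √N / 2) := by
        have h1 : Tendsto (fun N : ℕ => Real.pi * √N / 2) atTop atTop :=
          ((Real.tendsto_sqrt_atTop.comp tendsto_natCast_atTop_atTop).const_mul_atTop
            hpi).atTop_div_const two_pos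
        filter_upwards [h1.eventually_gt_atTop |x|] with N hN
        exact ⟨by linarith [neg_abs_le x], by linarith [le_abs_self x]⟩
      have h2 : Tendsto (fun N : ℕ => ((Real.cos (x / √N) ^ N : ℝ) : ℂ) *
          Complex.exp ((((N : ℝ) - 2 * v N) / √N : ℝ) * x * Complex.I)) atTop
          (𝓝 (((Real.exp (-x ^ 2 / 2) : ℝ) : ℂ) * Complex.exp ((-t : ℝ) * x * Complex.I))) := by
        refine ((Complex.continuous_ofReal.tendsto _).comp (tendsto_cos_div_sqrt_pow x)).mul ?_
        have hc : Continuous fun y : ℝ => Complex.exp (y * x * Complex.I) := by fun_prop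
        exact (hc.tendsto _).comp ht
      refine h2.congr' ?_
      filter_upwards [hev] with N hN
      simp only [f]
      rw [Set.indicator_of_mem hN]
  -- The characteristic function of the normal law, up to its normalization.
  have hval : ∫ x : ℝ, ((Real.exp (-x ^ 2 / 2) : ℝ) : ℂ) * Complex.exp ((-t : ℝ) * x * Complex.I)
      = ((√(2 * Real.pi) * Real.exp (-t ^ 2 / 2) : ℝ) : ℂ) := by
    have h1 : ∀ x : ℝ, ((Real.exp (-x ^ 2 / 2) : ℝ) : ℂ) * Complex.exp ((-t : ℝ) * x * Complex.I)
        = Complex.exp ((-(1 / 2) : ℝ) * x ^ 2 + ((-t : ℝ) * Complex.I) * x + 0) := by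
      intro x
      rw [Complex.ofReal_exp, ← Complex.exp_add]
      congr 1
      push_cast
      ring
    simp_rw [h1]
    rw [integral_cexp_quadratic (by rw [Complex.ofReal_re]; norm_num), mul_pow, Complex.I_sq,
      Complex.ofReal_mul, Complex.ofReal_exp, Real.sqrt_eq_rpow, Complex.ofReal_cpow (by positivity)]
    congr 2
    · push_cast; ring
    · push_cast; ring
    · push_cast; ring
  rw [hval] at hlim
  have h3 := hlim.const_mul (1 / (2 * (Real.pi : ℂ)))
  have h4 : Tendsto (fun N => ((levelWeight N (v N) : ℝ) : ℂ)) atTop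
      (𝓝 ((1 / √(2 * Real.pi) * Real.exp (-t ^ 2 / 2) : ℝ) : ℂ)) := by
    have e : (1 / (2 * (Real.pi : ℂ))) * ((√(2 * Real.pi) * Real.exp (-t ^ 2 / 2) : ℝ) : ℂ)
        = ((1 / √(2 * Real.pi) * Real.exp (-t ^ 2 / 2) : ℝ) : ℂ) := by
      have h5 : 1 / √(2 * Real.pi) = 1 / (2 * Real.pi) * √(2 * Real.pi) := by
        have hp : 0 < √(2 * Real.pi) := Real.sqrt_pos.2 (by positivity)
        rw [div_mul_eq_mul_div, one_mul, div_eq_div_iff hp.ne' (by positivity), one_mul,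
          Real.mul_self_sqrt (by positivity)]
      rw [h5]
      push_cast
      ring
    rw [e] at h3
    refine h3.congr' ?_
    filter_upwards [eventually_gt_atTop 0] with N hN
    exact (levelWeight_eq_integral hN (v N)).symm
  exact_mod_cast (Complex.continuous_re.tendsto _).comp h4

/-- The coefficients of the rescaled level set sums converge. With the generating function
`(1 - z)^v (1 + z)^(N - v)` the limit carries the sign `(-1) ^ k`. -/
theorem tendsto_levelCoeff (hv : ∀ᶠ N in atTop, v N ≤ N)
    (ht : Tendsto (fun N : ℕ => ((N : ℝ) - 2 * v N) / √N) atTop (𝓝 (-t))) (k : ℕ) :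
    Tendsto (fun N => levelCoeff N (v N) k) atTop (𝓝 ((-1) ^ k * hermiteCoeff t k)) := by
  have hchoose : Tendsto (fun N : ℕ => √((N.choose k : ℝ) * (1 / (N : ℝ)) ^ k)) atTop
      (𝓝 √(1 / k.factorial)) := by
    refine (Real.continuous_sqrt.tendsto _).comp ?_
    have h1 : Tendsto (fun n : ℕ => (n : ℝ) * (1 / (n : ℝ))) atTop (𝓝 1) := by
      refine tendsto_const_nhds.congr' ?_
      filter_upwards [eventually_gt_atTop 0] with N hN
      have : (N : ℝ) ≠ 0 := by exact_mod_cast hN.ne'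
      field_simp
    simpa using tendsto_choose_mul_pow_atTop k h1
  have hfac : (0 : ℝ) < k.factorial := by exact_mod_cast k.factorial_pos
  have h := (tendsto_levelWeight ht).mul ((tendsto_coeff_krawtPoly hv ht k).div hchoose
    (Real.sqrt_pos.2 (by positivity)).ne')
  have hlim : 1 / √(2 * Real.pi) * Real.exp (-t ^ 2 / 2) *
      ((-1) ^ k * hermiteH k t / k.factorial / √(1 / k.factorial)) = (-1) ^ k * hermiteCoeff t k := by
    have hs : 0 < √(k.factorial : ℝ) := Real.sqrt_pos.2 hfac
    have hsq : (k.factorial : ℝ) = √(k.factorial : ℝ) ^ 2 := (Real.sq_sqrt hfac.le).symm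
    have h6 : (1 : ℝ) / k.factorial / √(1 / k.factorial) = 1 / √(k.factorial : ℝ) := by
      rw [Real.sqrt_div zero_le_one, Real.sqrt_one]
      conv_lhs => rw [hsq, Real.sqrt_sq hs.le]
      field_simp
    rw [hermiteCoeff, ← h6]
    ring
  rw [← hlim]
  refine h.congr' ?_
  filter_upwards [eventually_gt_atTop 0] with N hN
  have hN1 : (0 : ℝ) < N := by exact_mod_cast hN
  have hs : 0 < √(N : ℝ) := Real.sqrt_pos.2 hN1
  rw [levelCoeff_eq, Pi.div_apply, Real.sqrt_mul (by positivity)]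
  have h7 : √((1 / (N : ℝ)) ^ k) = 1 / √N ^ k := by
    rw [← Real.sqrt_sq (by positivity : 0 ≤ 1 / √(N : ℝ) ^ k)]
    congr 1
    rw [div_pow, one_pow, div_pow, one_pow, ← pow_mul, mul_comm k 2, pow_mul, Real.sq_sqrt hN1.le]
  rw [h7]
  field_simp

lemma eventually_floor_le (t : ℝ) :
    ∀ᶠ N : ℕ in atTop, ⌊(N : ℝ) / 2 + √(N : ℝ) / 2 * t⌋₊ ≤ N := by
  have hev : ∀ᶠ N : ℕ in atTop, |t| ≤ √(N : ℝ) :=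
    (Real.tendsto_sqrt_atTop.comp tendsto_natCast_atTop_atTop).eventually_ge_atTop |t|
  filter_upwards [hev] with N hN
  refine Nat.floor_le_of_le ?_
  have hsq : √(N : ℝ) * √N = N := Real.mul_self_sqrt (Nat.cast_nonneg _)
  nlinarith [le_abs_self t, Real.sqrt_nonneg (N : ℝ)]

lemma tendsto_floor (t : ℝ) :
    Tendsto (fun N : ℕ => ((N : ℝ) - 2 * ⌊(N : ℝ) / 2 + √(N : ℝ) / 2 * t⌋₊) / √N) atTop
      (𝓝 (-t)) := by
  have hsqrt : Tendsto (fun N : ℕ => √(N : ℝ)) atTop atTop :=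
    Real.tendsto_sqrt_atTop.comp tendsto_natCast_atTop_atTop
  have hup : Tendsto (fun N : ℕ => -t + 2 / √(N : ℝ)) atTop (𝓝 (-t)) := by
    simpa using tendsto_const_nhds.add (hsqrt.const_div_atTop 2)
  refine tendsto_of_tendsto_of_tendsto_of_le_of_le' tendsto_const_nhds hup ?_ ?_
  · filter_upwards [hsqrt.eventually_ge_atTop |t|, eventually_gt_atTop 0] with N hN hN0
    have hs : 0 < √(N : ℝ) := Real.sqrt_pos.2 (by exact_mod_cast hN0)
    have hsq : √(N : ℝ) * √N = N := Real.mul_self_sqrt (Nat.cast_nonneg _)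
    have := Nat.floor_le (a := (N : ℝ) / 2 + √(N : ℝ) / 2 * t) (by nlinarith [neg_abs_le t])
    rw [le_div_iff₀ hs]
    linarith
  · filter_upwards [eventually_gt_atTop 0] with N hN0
    have hs : 0 < √(N : ℝ) := Real.sqrt_pos.2 (by exact_mod_cast hN0)
    have := Nat.lt_floor_add_one ((N : ℝ) / 2 + √(N : ℝ) / 2 * t)
    rw [div_le_iff₀ hs, add_mul, div_mul_cancel₀ _ hs.ne']
    linarith

end LocalLimit

/-! ### Weighted coefficient sums and processes -/

section MomentWeights

variable {Ω : Type*} [MeasurableSpace Ω] {Q : Measure Ω} {Y : Ω → ℝ}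

lemma integrable_abs_pow [IsFiniteMeasure Q] (hYm : AEMeasurable Y Q)
    (hYlt : ∀ᵐ ω ∂Q, |Y ω| < 1) (k : ℕ) :
    Integrable (fun ω => |Y ω| ^ k) Q := by
  refine Integrable.of_bound (by fun_prop) 1 ?_
  filter_upwards [hYlt] with ω hω
  rw [norm_pow, Real.norm_eq_abs, abs_abs]
  exact pow_le_one₀ (abs_nonneg _) hω.le

lemma rawMoment_le_integral_abs_pow (k : ℕ) : rawMoment Q Y k ≤ ∫ ω, |Y ω| ^ k ∂Q := by
  rw [rawMoment]
  refine (Real.le_norm_self _).trans ((norm_integral_le_integral_norm _).trans (le_of_eq ?_))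
  simp_rw [norm_pow, Real.norm_eq_abs]

/-- Summation against the absolute moments of `Y`: a bound of order `(1 - ρ²)^{-1/2}` on a power
series integrates to a finite sum. -/
lemma hasSum_integral_abs_pow_mul [IsFiniteMeasure Q] (hYm : AEMeasurable Y Q)
    (hYlt : ∀ᵐ ω ∂Q, |Y ω| < 1)
    (hint : Integrable (fun ω => (√(1 - Y ω ^ 2))⁻¹) Q) {D : ℕ → ℝ} (hD0 : ∀ k, 0 ≤ D k) {C : ℝ}
    (hD : ∀ ρ : ℝ, 0 ≤ ρ → ρ < 1 → Summable (fun k => ρ ^ k * D k) ∧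
      ∑' k, ρ ^ k * D k ≤ C * (√(1 - ρ ^ 2))⁻¹) :
    HasSum (fun k => (∫ ω, |Y ω| ^ k ∂Q) * D k) (∫ ω, ∑' k, |Y ω| ^ k * D k ∂Q) := by
  have hF : ∀ k, Integrable (fun ω => |Y ω| ^ k * D k) Q := fun k =>
    (integrable_abs_pow hYm hYlt k).mul_const _
  have hsum : Summable fun k => ∫ ω, |Y ω| ^ k * D k ∂Q := by
    refine summable_of_sum_range_le (c := ∫ ω, C * (√(1 - Y ω ^ 2))⁻¹ ∂Q)
      (fun k => integral_nonneg fun ω => mul_nonneg (by positivity) (hD0 k)) fun n => ?_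
    rw [← integral_finsetSum _ fun k _ => hF k]
    refine integral_mono_ae (integrable_finsetSum _ fun k _ => hF k) (hint.const_mul C) ?_
    filter_upwards [hYlt] with ω hω
    obtain ⟨h1, h2⟩ := hD |Y ω| (abs_nonneg _) hω
    rw [sq_abs] at h2
    exact (h1.sum_le_tsum _ fun k _ => mul_nonneg (by positivity) (hD0 k)).trans h2
  have h := hasSum_integral_of_summable_integral_norm hF (by
    refine hsum.congr fun k => integral_congr_ae (ae_of_all _ fun ω => ?_)
    exact (Real.norm_of_nonneg (mul_nonneg (by positivity) (hD0 k))).symm)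
  simpa only [integral_mul_const] using h

/-- Dominated convergence for series in the absolute moments: the bound `(1 - ρ²)^{-1/2}` dominates
both the sum over `k` at fixed `ρ` and the integral over `Y`. -/
lemma tendsto_integral_tsum_abs_pow (hYm : AEMeasurable Y Q) (hYlt : ∀ᵐ ω ∂Q, |Y ω| < 1)
    (hint : Integrable (fun ω => (√(1 - Y ω ^ 2))⁻¹) Q) {D : ℕ → ℕ → ℝ} (hD0 : ∀ N k, 0 ≤ D N k)
    {C : ℝ} (hD : ∀ N, ∀ ρ : ℝ, 0 ≤ ρ → ρ < 1 → Summable (fun k => ρ ^ k * D N k) ∧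
      ∑' k, ρ ^ k * D N k ≤ C * (√(1 - ρ ^ 2))⁻¹)
    (hlim : ∀ k, Tendsto (fun N => D N k) atTop (𝓝 0)) :
    Tendsto (fun N => ∫ ω, ∑' k, |Y ω| ^ k * D N k ∂Q) atTop (𝓝 0) := by
  rw [← integral_zero Ω ℝ (μ := Q)]
  refine tendsto_integral_of_dominated_convergence (fun ω => C * (√(1 - Y ω ^ 2))⁻¹)
    (fun N => ?_) (hint.const_mul C) (fun N => ?_) ?_
  · refine aestronglyMeasurable_of_tendsto_ae atTop
      (f := fun n ω => ∑ k ∈ Finset.range n, |Y ω| ^ k * D N k) (fun n => ?_) ?_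
    · exact AEMeasurable.aestronglyMeasurable (by fun_prop)
    · filter_upwards [hYlt] with ω hω
      exact (hD N _ (abs_nonneg _) hω).1.hasSum.tendsto_sum_nat
  · filter_upwards [hYlt] with ω hω
    rw [Real.norm_of_nonneg (tsum_nonneg fun k => mul_nonneg (by positivity) (hD0 N k))]
    have := (hD N _ (abs_nonneg (Y ω)) hω).2
    rwa [sq_abs] at this
  · filter_upwards [hYlt] with ω hω
    set ρ := |Y ω| with hρ
    have hρ0 : 0 ≤ ρ := abs_nonneg _
    -- the bound at a radius `r` beyond `ρ` dominates the series at `ρ` by a geometric one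
    set r := (1 + ρ) / 2 with hr
    have hr0 : 0 < r := by positivity
    have hr1 : r < 1 := by linarith
    have hρr : ρ < r := by linarith
    have hterm : ∀ N k, r ^ k * D N k ≤ C * (√(1 - r ^ 2))⁻¹ := fun N k =>
      ((hD N r hr0.le hr1).1.le_tsum k fun j _ => mul_nonneg (by positivity) (hD0 N j)).trans
        (hD N r hr0.le hr1).2
    have h := tendsto_tsum_of_dominated_convergence (𝓕 := atTop) (f := fun N k => ρ ^ k * D N k)
      (g := fun _ => (0 : ℝ)) (bound := fun k => (ρ / r) ^ k * (C * (√(1 - r ^ 2))⁻¹))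
      ((summable_geometric_of_lt_one (by positivity) ((div_lt_one hr0).2 hρr)).mul_right _)
      (fun k => by simpa using (hlim k).const_mul (ρ ^ k))
      (Eventually.of_forall fun N k => by
        rw [Real.norm_of_nonneg (mul_nonneg (by positivity) (hD0 N k))]
        calc ρ ^ k * D N k = (ρ / r) ^ k * (r ^ k * D N k) := by
              rw [div_pow]; field_simp
          _ ≤ _ := mul_le_mul_of_nonneg_left (hterm N k) (by positivity))
    simpa using h

end MomentWeights

section Coefficients

lemma summable_pow_mul_sq_hermiteCoeff (t : ℝ) {ρ : ℝ} (hρ : |ρ| < 1) :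
    Summable (fun k => ρ ^ k * hermiteCoeff t k ^ 2) ∧
      ∑' k, ρ ^ k * hermiteCoeff t k ^ 2 ≤ (√(1 - ρ ^ 2))⁻¹ := by
  have h := hasSum_mehler hρ t t
  simp_rw [← sq] at h
  exact ⟨h.summable, h.tsum_eq.trans_le (bivariateNormalDensity_le hρ t t).2⟩

/-- The finite and the limiting Mehler bounds together, for the difference of the coefficients. -/
lemma summable_pow_mul_sq_sub (N v : ℕ) (t : ℝ) {ρ : ℝ} (h0 : 0 ≤ ρ) (h1 : ρ < 1) :
    Summable (fun k => ρ ^ k * ((-1) ^ k * levelCoeff N v k - hermiteCoeff t k) ^ 2) ∧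
      ∑' k, ρ ^ k * ((-1) ^ k * levelCoeff N v k - hermiteCoeff t k) ^ 2
        ≤ 4 * (√(1 - ρ ^ 2))⁻¹ := by
  have hρ : |ρ| < 1 := by rwa [abs_of_nonneg h0]
  obtain ⟨ha, ha'⟩ := summable_pow_mul_sq_hermiteCoeff t hρ
  have hsupp : ∀ k ∉ Finset.range (N + 1), ρ ^ k * levelCoeff N v k ^ 2 = 0 := fun k hk => by
    rw [levelCoeff_eq_zero (by simpa using hk)]; ring
  have hb : Summable fun k => ρ ^ k * levelCoeff N v k ^ 2 := summable_of_ne_finset_zero hsupp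
  have hb' : ∑' k, ρ ^ k * levelCoeff N v k ^ 2 ≤ (√(1 - ρ ^ 2))⁻¹ := by
    rw [tsum_eq_sum hsupp]
    exact sum_pow_mul_sq_levelCoeff_le N v hρ
  have hle : ∀ k, ρ ^ k * ((-1) ^ k * levelCoeff N v k - hermiteCoeff t k) ^ 2
      ≤ 2 * (ρ ^ k * levelCoeff N v k ^ 2) + 2 * (ρ ^ k * hermiteCoeff t k ^ 2) := fun k => by
    have hs : ((-1 : ℝ) ^ k) ^ 2 = 1 := by rw [← pow_mul, mul_comm, pow_mul]; simp
    have h2 : ((-1) ^ k * levelCoeff N v k - hermiteCoeff t k) ^ 2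
        ≤ 2 * levelCoeff N v k ^ 2 + 2 * hermiteCoeff t k ^ 2 := by
      have := sq_nonneg ((-1) ^ k * levelCoeff N v k + hermiteCoeff t k)
      have e : ((-1 : ℝ) ^ k * levelCoeff N v k) ^ 2 = levelCoeff N v k ^ 2 := by
        rw [mul_pow, hs, one_mul]
      nlinarith
    nlinarith [pow_nonneg h0 k]
  have hs := (hb.mul_left 2).add (ha.mul_left 2)
  have hsum := hs.of_nonneg_of_le (fun k => mul_nonneg (pow_nonneg h0 k) (sq_nonneg _)) hle
  refine ⟨hsum, (hsum.tsum_le_tsum hle hs).trans ?_⟩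
  rw [(hb.mul_left 2).tsum_add (ha.mul_left 2), tsum_mul_left, tsum_mul_left]
  linarith

lemma measurable_bivariateNormalDensity (t s : ℝ) : Measurable (bivariateNormalDensity t s) := by
  unfold bivariateNormalDensity
  fun_prop

end Coefficients

section Series

lemma kappaPartial_eq {Ω : Type*} (ζ : ℕ → Ω → ℝ) (m : ℕ → ℝ) (n : ℕ) (t : ℝ) (ω : Ω) :
    kappaPartial m ζ n t ω = partialSum ζ (fun k => m k * hermiteCoeff t k) n ω := by
  rw [kappaPartial, partialSum, Finset.mul_sum]
  refine Finset.sum_congr rfl fun k _ => ?_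
  rw [hermiteCoeff]
  ring

variable {Ω : Type*} [MeasurableSpace Ω] {P : Measure Ω} [IsProbabilityMeasure P]
  {ζ : ℕ → Ω → ℝ}

/-- Gaussian series in common variables `ζ` form a Gaussian process. -/
lemma isGaussianProcess_of_ae_tendsto_partialSum {T : Type*}
    (hlaw : ∀ k, HasLaw (ζ k) (gaussianReal 0 1) P) (hind : iIndepFun ζ P) {a : T → ℕ → ℝ}
    (ha : ∀ t, Summable fun k => a t k ^ 2) {S : T → Ω → ℝ}
    (hS : ∀ t, ∀ᵐ ω ∂P, Tendsto (fun n => partialSum ζ (a t) n ω) atTop (𝓝 (S t ω))) :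
    IsGaussianProcess S P := by
  classical
  refine ⟨fun I => ⟨?_⟩⟩
  have hSm : AEMeasurable (fun ω => I.restrict (S · ω)) P :=
    aemeasurable_pi_iff.2 fun t => aemeasurable_of_ae_tendsto_partialSum hlaw (hS t)
  -- A linear functional of finitely many series is again a series, whose law is known.
  refine isGaussian_of_map_eq_gaussianReal fun L => ?_
  let c : I → ℝ := fun i => L (Pi.single i 1)
  have hL : ∀ x, L x = ∑ i, c i * x i := fun x => by
    conv_lhs => rw [← Finset.univ_sum_single x, map_sum]
    refine Finset.sum_congr rfl fun i _ => ?_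
    have : Pi.single i (x i) = x i • (Pi.single i (1 : ℝ) : I → ℝ) := by
      rw [← Pi.single_smul', smul_eq_mul, mul_one]
    rw [this, map_smul, smul_eq_mul, mul_comm]
  have hc : Summable fun k => (∑ i, c i * a i k) ^ 2 := by
    have : ∀ J : Finset I, Summable fun k => (∑ i ∈ J, c i * a i k) ^ 2 := by
      intro J
      induction J using Finset.induction_on with
      | empty => simp [summable_zero]
      | insert i J hi ih =>
        simp_rw [Finset.sum_insert hi]
        refine summable_sq_add ?_ ih
        simp_rw [mul_pow]
        exact (ha i).mul_left _
    exact this _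
  have hlim : ∀ᵐ ω ∂P, Tendsto (fun n => partialSum ζ (fun k => ∑ i, c i * a i k) n ω) atTop
      (𝓝 (L (I.restrict (S · ω)))) := by
    filter_upwards [ae_all_iff.2 fun i : I => hS i] with ω hω
    have h1 : ∀ n, partialSum ζ (fun k => ∑ i, c i * a i k) n ω
        = ∑ i, c i * partialSum ζ (a i) n ω := by
      intro n
      simp only [partialSum, Finset.sum_mul, Finset.mul_sum]
      rw [Finset.sum_comm]
      simp only [mul_assoc]
    simp_rw [h1, hL]
    exact tendsto_finsetSum _ fun i _ => (hω i).const_mul (c i)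
  refine ⟨0, (∑' k, (∑ i, c i * a i k) ^ 2).toNNReal, ?_⟩
  rw [AEMeasurable.map_map_of_aemeasurable L.continuous.aemeasurable hSm]
  exact (hasLaw_of_ae_tendsto_partialSum hlaw hind hc hlim).map_eq

lemma ae_tendsto_kappa (hlaw : ∀ k, HasLaw (ζ k) (gaussianReal 0 1) P) (hind : iIndepFun ζ P)
    {m : ℕ → ℝ} {t : ℝ} (ha : Summable fun k => (m k * hermiteCoeff t k) ^ 2) :
    ∀ᵐ ω ∂P, Tendsto (fun n => partialSum ζ (fun k => m k * hermiteCoeff t k) n ω) atTop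
      (𝓝 (kappa m ζ t ω)) := by
  filter_upwards [exists_ae_tendsto_partialSum hlaw hind ha] with ω hω
  unfold kappa
  simp_rw [kappaPartial_eq]
  exact tendsto_nhds_limUnder hω

end Series

section LevelSums

/-- The rescaled level set sums at the levels `v t`, as a linear map of the Gaussian vector. -/
def levelMap (m : ℕ → ℝ) (N : ℕ) {T : Type*} (v : T → ℕ) (x : Fin (N + 1) → ℝ) (t : T) : ℝ :=
  ∑ k : Fin (N + 1), m k * levelCoeff N (v t) k * x k

lemma measurable_levelMap (m : ℕ → ℝ) (N : ℕ) {T : Type*} (v : T → ℕ) :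
    Measurable (levelMap m N v) := by
  refine measurable_pi_iff.2 fun t => ?_
  unfold levelMap
  fun_prop

lemma levelSum_eq_zero {N v : ℕ} (h : N < v) {Ω : Type*} (g : Cube N → Ω → ℝ) (ω : Ω) :
    levelSum g v ω = 0 := by
  unfold levelSum
  rw [Finset.filter_false_of_mem, Finset.sum_empty]
  intro y _ hy
  have := hammingNorm_le_card_fintype (x := y)
  rw [hy, Fintype.card_fin] at this
  omega

/-- Levels above `N` are included: both sides vanish there. -/
lemma ae_levelSum_eq {N : ℕ} {Ω : Type*} [MeasurableSpace Ω] {P : Measure Ω} {g : Cube N → Ω → ℝ}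
    {m : ℕ → ℝ} {x : Fin (N + 1) → Ω → ℝ}
    (hg : ∀ v, v ≤ N → ∀ᵐ ω ∂P, levelSum g v ω = (N.choose v : ℝ) * (1 / (2 : ℝ) ^ ((N : ℝ) / 2)) *
      ∑ k : Fin (N + 1), m k * √(N.choose k : ℝ) * krawtchouk N k v * x k ω)
    {T : Type*} [Countable T] (v : T → ℕ) :
    ∀ᵐ ω ∂P, (fun t => 1 / 2 * √((N : ℝ) / 2 ^ N) * levelSum g (v t) ω)
      = levelMap m N v fun k => x k ω := by
  have h : ∀ t, ∀ᵐ ω ∂P, 1 / 2 * √((N : ℝ) / 2 ^ N) * levelSum g (v t) ω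
      = levelMap m N v (fun k => x k ω) t := by
    intro t
    rcases lt_or_ge N (v t) with hv | hv
    · refine ae_of_all _ fun ω => ?_
      rw [levelSum_eq_zero hv, mul_zero, levelMap]
      exact (Finset.sum_eq_zero fun k _ => by rw [levelCoeff_eq_zero_of_lt hv]; ring).symm
    · filter_upwards [hg _ hv] with ω hω
      rw [hω, levelMap, Finset.mul_sum, Finset.mul_sum]
      refine Finset.sum_congr rfl fun k _ => ?_
      rw [levelCoeff]
      ring
  filter_upwards [ae_all_iff.2 h] with ω hω
  exact funext hω

/-- The standard normal law is symmetric. -/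
lemma hasLaw_neg_one_pow_mul {Ω : Type*} [MeasurableSpace Ω] {P : Measure Ω} {X : Ω → ℝ}
    (hX : HasLaw X (gaussianReal 0 1) P) (k : ℕ) :
    HasLaw (fun ω => (-1) ^ k * X ω) (gaussianReal 0 1) P := by
  have h := gaussianReal_map_const_mul (μ := 0) (v := 1) ((-1 : ℝ) ^ k)
  have h2 : HasLaw (fun x : ℝ => (-1) ^ k * x) (gaussianReal 0 1) (gaussianReal 0 1) := by
    refine ⟨by fun_prop, ?_⟩
    rw [h]
    congr 1
    · simp
    · ext
      simp [← pow_mul, mul_comm k 2]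
  exact h2.comp hX

/-- Two families of independent standard normal variables have the same joint law, whatever signs
are attached to one of them. -/
lemma map_eq_map_of_gaussian {N : ℕ} {Ω Ω' : Type*} [MeasurableSpace Ω] [MeasurableSpace Ω']
    {P : Measure Ω} {P' : Measure Ω'} [IsProbabilityMeasure P] [IsProbabilityMeasure P']
    {ζ : ℕ → Ω → ℝ} (hlaw : ∀ k, HasLaw (ζ k) (gaussianReal 0 1) P) (hind : iIndepFun ζ P)
    {ζ' : Fin N → Ω' → ℝ} (hlaw' : ∀ k, HasLaw (ζ' k) (gaussianReal 0 1) P')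
    (hind' : iIndepFun ζ' P') :
    P'.map (fun ω k => ζ' k ω) = P.map (fun ω (k : Fin N) => (-1) ^ (k : ℕ) * ζ k ω) := by
  have h1 := (iIndepFun_iff_map_fun_eq_pi_map fun k => (hlaw' k).aemeasurable).1 hind'
  have hlaw2 : ∀ k : Fin N, HasLaw (fun ω => (-1) ^ (k : ℕ) * ζ k ω) (gaussianReal 0 1) P :=
    fun k => hasLaw_neg_one_pow_mul (hlaw k) k
  have hind2 : iIndepFun (fun (k : Fin N) ω => (-1) ^ (k : ℕ) * ζ k ω) P :=
    (hind.precomp (g := fun k : Fin N => (k : ℕ)) Fin.val_injective).comp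
      (fun k x => (-1) ^ (k : ℕ) * x) fun k => by fun_prop
  have h2 := (iIndepFun_iff_map_fun_eq_pi_map fun k => (hlaw2 k).aemeasurable).1 hind2
  rw [h1, h2]
  congr 1
  funext k
  rw [(hlaw' k).map_eq, (hlaw2 k).map_eq]

/-- Convergence in mean square of finitely many coordinates implies convergence in probability of
the vector. -/
lemma tendstoInMeasure_pi {Ω : Type*} [MeasurableSpace Ω] {P : Measure Ω} {T : Type*} [Fintype T]
    {X : ℕ → T → Ω → ℝ} {S : T → Ω → ℝ} (hX : ∀ N t, AEMeasurable (X N t) P)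
    (hS : ∀ t, AEMeasurable (S t) P)
    (h : ∀ t, Tendsto (fun N => eLpNorm (fun ω => X N t ω - S t ω) 2 P) atTop (𝓝 0)) :
    TendstoInMeasure P (fun N ω t => X N t ω) atTop fun ω t => S t ω := by
  refine tendstoInMeasure_of_tendsto_eLpNorm two_ne_zero
    (fun N => (aemeasurable_pi_iff.2 fun t => hX N t).aestronglyMeasurable)
    (aemeasurable_pi_iff.2 hS).aestronglyMeasurable ?_
  have hsum : Tendsto (fun N => ∑ t, eLpNorm (fun ω => X N t ω - S t ω) 2 P) atTop (𝓝 0) := by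
    simpa using tendsto_finsetSum Finset.univ fun t _ => h t
  refine tendsto_of_tendsto_of_tendsto_of_le_of_le tendsto_const_nhds hsum (fun N => zero_le)
    fun N => ?_
  calc _ ≤ eLpNorm (∑ t, fun ω => ‖X N t ω - S t ω‖) 2 P := by
        refine eLpNorm_mono fun ω => ?_
        rw [Finset.sum_apply, Real.norm_of_nonneg (Finset.sum_nonneg fun t _ => norm_nonneg _)]
        refine (pi_norm_le_iff_of_nonneg (Finset.sum_nonneg fun t _ => norm_nonneg _)).2 fun t => ?_
        exact Finset.single_le_sum (f := fun t => ‖X N t ω - S t ω‖) (fun t _ => norm_nonneg _)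
          (Finset.mem_univ t)
    _ ≤ ∑ t, eLpNorm (fun ω => ‖X N t ω - S t ω‖) 2 P :=
        eLpNorm_sum_le (fun t _ => ((hX N t).sub (hS t)).aestronglyMeasurable.norm) (by norm_num)
    _ = _ := Finset.sum_congr rfl fun t _ => eLpNorm_norm _

end LevelSums

/-! ### Covariance and convergence -/

/-- The partial sums of a finitely supported series are eventually constant. -/
lemma tendsto_partialSum_of_eq_zero {Ω : Type*} (ζ : ℕ → Ω → ℝ) {a : ℕ → ℝ} {n : ℕ}
    (h : ∀ k, n ≤ k → a k = 0) (ω : Ω) :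
    Tendsto (fun j => partialSum ζ a j ω) atTop (𝓝 (partialSum ζ a n ω)) := by
  refine tendsto_const_nhds.congr' ?_
  filter_upwards [eventually_ge_atTop n] with j hj
  refine Finset.sum_subset (Finset.range_subset_range.2 hj) fun k _ hk => ?_
  rw [h k (by simpa using hk), zero_mul]

lemma levelMap_eq_partialSum {Ω : Type*} (ζ : ℕ → Ω → ℝ) (m : ℕ → ℝ) (N : ℕ) {T : Type*}
    (v : T → ℕ) (t : T) (ω : Ω) :
    levelMap m N v (fun k => (-1) ^ (k : ℕ) * ζ k ω) t
      = partialSum ζ (fun k => m k * ((-1) ^ k * levelCoeff N (v t) k)) (N + 1) ω := by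
  rw [levelMap, partialSum, ← Fin.sum_univ_eq_sum_range
    (fun k => m k * ((-1) ^ k * levelCoeff N (v t) k) * ζ k ω)]
  exact Finset.sum_congr rfl fun k _ => by ring

section Limit

variable {ΩY : Type*} [MeasurableSpace ΩY] {Q : Measure ΩY} {Y : ΩY → ℝ} {m : ℕ → ℝ}

lemma integrable_bivariateNormalDensity (hYm : AEMeasurable Y Q) (hYlt : ∀ᵐ ω ∂Q, |Y ω| < 1)
    (hint : Integrable (fun ω => (√(1 - Y ω ^ 2))⁻¹) Q) (t s : ℝ) :
    Integrable (fun ω => bivariateNormalDensity t s (Y ω)) Q := by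
  refine hint.mono' ((measurable_bivariateNormalDensity t s).comp_aemeasurable hYm
    ).aestronglyMeasurable ?_
  filter_upwards [hYlt] with ω hω
  obtain ⟨h0, h1⟩ := bivariateNormalDensity_le hω t s
  rwa [Real.norm_of_nonneg h0]

variable [IsProbabilityMeasure Q]

/-- Mehler's formula on the diagonal bounds the sum of squares by `E(1 - Y²)^{-1/2}`. -/
lemma summable_sq_mul_hermiteCoeff (hYm : AEMeasurable Y Q) (hYlt : ∀ᵐ ω ∂Q, |Y ω| < 1)
    (hint : Integrable (fun ω => (√(1 - Y ω ^ 2))⁻¹) Q) (hm : ∀ k, m k ^ 2 = rawMoment Q Y k)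
    (t : ℝ) : Summable fun k => (m k * hermiteCoeff t k) ^ 2 := by
  have h := (hasSum_integral_abs_pow_mul hYm hYlt hint (D := fun k => hermiteCoeff t k ^ 2)
    (C := 1) (fun k => sq_nonneg _) fun ρ h0 h1 => by
      rw [one_mul]
      exact summable_pow_mul_sq_hermiteCoeff t (by rwa [abs_of_nonneg h0])).summable
  refine h.of_nonneg_of_le (fun k => sq_nonneg _) fun k => ?_
  rw [mul_pow, hm]
  exact mul_le_mul_of_nonneg_right (rawMoment_le_integral_abs_pow k) (sq_nonneg _)

/-- The expectation of Mehler's formula. -/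
lemma hasSum_rawMoment_mul_hermiteCoeff (hYm : AEMeasurable Y Q) (hYlt : ∀ᵐ ω ∂Q, |Y ω| < 1)
    (hint : Integrable (fun ω => (√(1 - Y ω ^ 2))⁻¹) Q) (t s : ℝ) :
    HasSum (fun k => rawMoment Q Y k * (hermiteCoeff t k * hermiteCoeff s k))
      (∫ ω, bivariateNormalDensity t s (Y ω) ∂Q) := by
  have hD : ∀ t : ℝ, Summable fun k => (∫ ω, |Y ω| ^ k ∂Q) * hermiteCoeff t k ^ 2 := fun t =>
    (hasSum_integral_abs_pow_mul hYm hYlt hint (D := fun k => hermiteCoeff t k ^ 2)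
      (C := 1) (fun k => sq_nonneg _) fun ρ h0 h1 => by
        rw [one_mul]
        exact summable_pow_mul_sq_hermiteCoeff t (by rwa [abs_of_nonneg h0])).summable
  have hpow : ∀ k, Integrable (fun ω => Y ω ^ k) Q := fun k =>
    (integrable_abs_pow hYm hYlt k).mono' (by fun_prop)
      (ae_of_all _ fun ω => by rw [norm_pow, Real.norm_eq_abs])
  have h := hasSum_integral_of_summable_integral_norm (μ := Q)
    (F := fun k ω => Y ω ^ k * (hermiteCoeff t k * hermiteCoeff s k))
    (fun k => (hpow k).mul_const _) (by
      refine ((hD t).add (hD s)).of_nonneg_of_le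
        (fun k => integral_nonneg fun ω => norm_nonneg _) fun k => ?_
      simp_rw [norm_mul, norm_pow, Real.norm_eq_abs, integral_mul_const]
      rw [← mul_add]
      refine mul_le_mul_of_nonneg_left ?_ (integral_nonneg fun ω => by positivity)
      nlinarith [sq_nonneg (|hermiteCoeff t k| - |hermiteCoeff s k|),
        sq_abs (hermiteCoeff t k), sq_abs (hermiteCoeff s k),
        sq_nonneg (hermiteCoeff t k), sq_nonneg (hermiteCoeff s k)])
  simp_rw [integral_mul_const] at h
  refine (integral_congr_ae ?_ : _ = ∫ ω, bivariateNormalDensity t s (Y ω) ∂Q) ▸ h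
  filter_upwards [hYlt] with ω hω
  exact (hasSum_mehler hω t s).tsum_eq

variable {Ω : Type*} [MeasurableSpace Ω] {P : Measure Ω} [IsProbabilityMeasure P] {ζ : ℕ → Ω → ℝ}

/-- With the Gaussian vector of the `N`-th field coupled to the variables of the limit series, the
rescaled level set sums converge in mean square. -/
lemma tendsto_eLpNorm_levelMap_sub_kappa (hYm : AEMeasurable Y Q) (hYlt : ∀ᵐ ω ∂Q, |Y ω| < 1)
    (hint : Integrable (fun ω => (√(1 - Y ω ^ 2))⁻¹) Q) (hm : ∀ k, m k ^ 2 = rawMoment Q Y k)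
    (hlaw : ∀ k, HasLaw (ζ k) (gaussianReal 0 1) P) (hind : iIndepFun ζ P) {T : Type*}
    {v : ℕ → T → ℕ} (t : T) (x : ℝ)
    (hv : ∀ k, Tendsto (fun N => levelCoeff N (v N t) k) atTop (𝓝 ((-1) ^ k * hermiteCoeff x k))) :
    Tendsto (fun N => eLpNorm (fun ω =>
      levelMap m N (v N) (fun k => (-1) ^ (k : ℕ) * ζ k ω) t - kappa m ζ x ω) 2 P)
      atTop (𝓝 0) := by
  set D : ℕ → ℕ → ℝ := fun N k => ((-1) ^ k * levelCoeff N (v N t) k - hermiteCoeff x k) ^ 2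
    with hDdef
  have hD0 : ∀ N k, 0 ≤ D N k := fun N k => sq_nonneg _
  have hD := fun N (ρ : ℝ) (h0 : 0 ≤ ρ) (h1 : ρ < 1) =>
    summable_pow_mul_sq_sub N (v N t) x h0 h1
  have hDlim : ∀ k, Tendsto (fun N => D N k) atTop (𝓝 0) := fun k => by
    have h := (((hv k).const_mul ((-1) ^ k)).sub_const (hermiteCoeff x k)).pow 2
    rw [← mul_assoc, ← mul_pow] at h
    simpa using h
  have hI := tendsto_integral_tsum_abs_pow hYm hYlt hint hD0 hD hDlim
  have hle : ∀ N k, (m k * ((-1) ^ k * levelCoeff N (v N t) k) + (-1) * (m k * hermiteCoeff x k)) ^ 2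
      ≤ (∫ ω, |Y ω| ^ k ∂Q) * D N k := fun N k => by
    have e : (m k * ((-1) ^ k * levelCoeff N (v N t) k) + (-1) * (m k * hermiteCoeff x k)) ^ 2
        = rawMoment Q Y k * D N k := by rw [← hm, hDdef]; ring
    rw [e]
    exact mul_le_mul_of_nonneg_right (rawMoment_le_integral_abs_pow k) (hD0 N k)
  have ha := summable_sq_mul_hermiteCoeff hYm hYlt hint hm x
  have hbound : ∀ N, eLpNorm (fun ω =>
      levelMap m N (v N) (fun k => (-1) ^ (k : ℕ) * ζ k ω) t - kappa m ζ x ω) 2 P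
      ≤ ENNReal.ofReal √(∫ ω, ∑' k, |Y ω| ^ k * D N k ∂Q) := fun N => by
    have hs := hasSum_integral_abs_pow_mul hYm hYlt hint (hD0 N) (hD N)
    have hsum := hs.summable.of_nonneg_of_le (fun k => sq_nonneg _) (hle N)
    refine (eLpNorm_le_of_ae_tendsto_partialSum hlaw hind hsum ?_).trans
      (ENNReal.ofReal_le_ofReal (Real.sqrt_le_sqrt ?_))
    · filter_upwards [ae_tendsto_kappa hlaw hind ha] with ω hω
      rw [levelMap_eq_partialSum]
      have h1 := tendsto_partialSum_of_eq_zero ζ (n := N + 1)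
        (a := fun k => m k * ((-1) ^ k * levelCoeff N (v N t) k)) (fun k hk => by
          rw [levelCoeff_eq_zero hk]; ring) ω
      refine (h1.sub hω).congr fun n => ?_
      rw [← partialSum_sub]
      exact Finset.sum_congr rfl fun k _ => by ring
    · exact (hsum.tsum_le_tsum (hle N) hs.summable).trans_eq hs.tsum_eq
  refine tendsto_of_tendsto_of_tendsto_of_le_of_le tendsto_const_nhds ?_ (fun N => zero_le) hbound
  have := (ENNReal.continuous_ofReal.comp Real.continuous_sqrt).tendsto 0
  simp only [Function.comp_apply, Real.sqrt_zero, ENNReal.ofReal_zero] at this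
  exact this.comp hI

end Limit

/-- Convergence in distribution of the level set sums, by transfer from the coupled copies. -/
lemma tendstoInDistribution_levelSum {Ω : Type*} [MeasurableSpace Ω] {P : Measure Ω}
    [IsProbabilityMeasure P] {ζ : ℕ → Ω → ℝ} (hlaw : ∀ k, HasLaw (ζ k) (gaussianReal 0 1) P)
    (hind : iIndepFun ζ P) {Ω' : ℕ → Type*} [∀ N, MeasurableSpace (Ω' N)]
    {P' : ∀ N, Measure (Ω' N)} [∀ N, IsProbabilityMeasure (P' N)]
    {g : ∀ N, Cube N → Ω' N → ℝ} {ζ' : ∀ N, Fin (N + 1) → Ω' N → ℝ}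
    (hlaw' : ∀ N k, HasLaw (ζ' N k) (gaussianReal 0 1) (P' N))
    (hind' : ∀ N, iIndepFun (ζ' N) (P' N)) {m : ℕ → ℝ}
    (hg : ∀ N v, v ≤ N → ∀ᵐ ω ∂(P' N), levelSum (g N) v ω =
      (N.choose v : ℝ) * (1 / (2 : ℝ) ^ ((N : ℝ) / 2)) *
        ∑ k : Fin (N + 1), m k * √(N.choose k : ℝ) * krawtchouk N k v * ζ' N k ω)
    {T : Type*} [Fintype T] (v : ℕ → T → ℕ) {S : T → Ω → ℝ} (hS : ∀ t, AEMeasurable (S t) P)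
    (h : ∀ t, Tendsto (fun N => eLpNorm (fun ω =>
      levelMap m N (v N) (fun k => (-1) ^ (k : ℕ) * ζ k ω) t - S t ω) 2 P) atTop (𝓝 0)) :
    TendstoInDistribution
      (fun (N : ℕ) ω t => 1 / 2 * √((N : ℝ) / 2 ^ N) * levelSum (g N) (v N t) ω) atTop
      (fun ω t => S t ω) P' P := by
  have hζm : ∀ N, AEMeasurable (fun ω (k : Fin (N + 1)) => (-1) ^ (k : ℕ) * ζ k ω) P := fun N =>
    aemeasurable_pi_iff.2 fun k => (hlaw k).aemeasurable.const_mul _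
  have hζm' : ∀ N, AEMeasurable (fun ω k => ζ' N k ω) (P' N) := fun N =>
    aemeasurable_pi_iff.2 fun k => (hlaw' N k).aemeasurable
  have hXm : ∀ N, AEMeasurable
      (fun ω => levelMap m N (v N) fun k => (-1) ^ (k : ℕ) * ζ k ω) P := fun N =>
    (measurable_levelMap m N (v N)).comp_aemeasurable (hζm N)
  have hcoupled := (tendstoInMeasure_pi (fun N t => aemeasurable_pi_iff.1 (hXm N) t) hS
    h).tendstoInDistribution hXm
  have hYm : ∀ N : ℕ, AEMeasurable
      (fun ω t => 1 / 2 * √((N : ℝ) / 2 ^ N) * levelSum (g N) (v N t) ω) (P' N) := fun N =>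
    ((measurable_levelMap m N (v N)).comp_aemeasurable (hζm' N)).congr
      ((ae_levelSum_eq (hg N) (v N)).mono fun ω hω => hω.symm)
  have hmap : ∀ N : ℕ, (P' N).map (fun ω t => 1 / 2 * √((N : ℝ) / 2 ^ N) * levelSum (g N) (v N t) ω)
      = P.map (fun ω => levelMap m N (v N) fun k => (-1) ^ (k : ℕ) * ζ k ω) := fun N => by
    rw [Measure.map_congr (ae_levelSum_eq (hg N) (v N))]
    have h1 := AEMeasurable.map_map_of_aemeasurable
      (measurable_levelMap m N (v N)).aemeasurable (hζm' N)
    have h2 := AEMeasurable.map_map_of_aemeasurable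
      (measurable_levelMap m N (v N)).aemeasurable (hζm N)
    rw [map_eq_map_of_gaussian hlaw hind (hlaw' N) (hind' N)] at h1
    exact h1.symm.trans h2
  refine ⟨hYm, hcoupled.aemeasurable_limit, hcoupled.tendsto.congr fun N => ?_⟩
  exact Subtype.ext (hmap N).symm

end HypercubeField

end

open HypercubeField in
theorem proposition4
    -- the measure on `[-1, 1]`, with finite integrals of `1 - ξ ^ k`
    (ν : Measure SpinInterval) (hν : Integrable (fun ξ : SpinInterval => 1 - (ξ : ℝ)) ν)
    -- the products of points `Y` and `Y_{1/2}`
    {ΩY : Type*} [MeasurableSpace ΩY] (QY : Measure ΩY) [IsProbabilityMeasure QY]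
    (Y : ΩY → ℝ) (hY : IsProductOfPoints QY ν 1 Y)
    {ΩH : Type*} [MeasurableSpace ΩH] (QH : Measure ΩH) [IsProbabilityMeasure QH]
    (Yhalf : ΩH → ℝ) (hYhalf : IsProductOfPoints QH ν (1 / 2) Yhalf)
    -- `E[(1 - Y) ^ (-1/2)] < ∞`, where the integrand is `∞` at `Y = 1`
    (hfin : ∫⁻ ω, (ENNReal.ofReal (1 - Y ω)) ^ (-(1 / 2) : ℝ) ∂QY < ⊤)
    -- the i.i.d. standard normal variables of the series
    {Ω : Type*} [MeasurableSpace Ω] (P : Measure Ω) [IsProbabilityMeasure P]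
    (ζ : ℕ → Ω → ℝ) (hζ_law : ∀ k, HasLaw (ζ k) (gaussianReal 0 1) P) (hζ_ind : iIndepFun ζ P)
    -- for each `N`, the field on the hypercube and the representation of its level set sums
    {Ω' : ℕ → Type*} [∀ N, MeasurableSpace (Ω' N)] (P' : ∀ N, Measure (Ω' N))
    [∀ N, IsProbabilityMeasure (P' N)]
    (g : ∀ N, Cube N → Ω' N → ℝ)
    (ζ' : ∀ N, Fin (N + 1) → Ω' N → ℝ)
    (hζ'_law : ∀ N k, HasLaw (ζ' N k) (gaussianReal 0 1) (P' N))
    (hζ'_ind : ∀ N, iIndepFun (ζ' N) (P' N))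
    (hg : ∀ N v, v ≤ N → ∀ᵐ ω ∂(P' N), levelSum (g N) v ω =
      (N.choose v : ℝ) * (1 / (2 : ℝ) ^ ((N : ℝ) / 2)) *
        ∑ k : Fin (N + 1), rawMoment QH Yhalf k * √(N.choose k : ℝ) * krawtchouk N k v *
          ζ' N k ω) :
    -- the series converges almost surely and in mean square, for every `t`
    (∀ t, ∀ᵐ ω ∂P, Tendsto (fun n => kappaPartial (rawMoment QH Yhalf) ζ n t ω) atTop
      (𝓝 (kappa (rawMoment QH Yhalf) ζ t ω))) ∧
    (∀ t, MemLp (kappa (rawMoment QH Yhalf) ζ t) 2 P ∧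
      Tendsto (fun n => eLpNorm (fun ω => kappaPartial (rawMoment QH Yhalf) ζ n t ω -
        kappa (rawMoment QH Yhalf) ζ t ω) 2 P) atTop (𝓝 0)) ∧
    -- the sum is a centered Gaussian process
    IsGaussianProcess (kappa (rawMoment QH Yhalf) ζ) P ∧
    (∀ t, ∫ ω, kappa (rawMoment QH Yhalf) ζ t ω ∂P = 0) ∧
    -- the covariance function as a series
    (∀ t s,
      Summable (fun k : ℕ => rawMoment QY Y (k + 1) * (1 / ((k + 1).factorial : ℝ)) *
        hermiteH (k + 1) t * hermiteH (k + 1) s) ∧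
      cov[kappa (rawMoment QH Yhalf) ζ t, kappa (rawMoment QH Yhalf) ζ s; P] =
        1 / (2 * Real.pi) * Real.exp (-(t ^ 2 + s ^ 2) / 2) *
          (1 + ∑' k : ℕ, rawMoment QY Y (k + 1) * (1 / ((k + 1).factorial : ℝ)) *
            hermiteH (k + 1) t * hermiteH (k + 1) s)) ∧
    -- the covariance function as a mixture of bivariate normal densities
    (∀ᵐ ω ∂QY, |Y ω| < 1) ∧
    (∀ t s,
      Integrable (fun ω => bivariateNormalDensity t s (Y ω)) QY ∧
      cov[kappa (rawMoment QH Yhalf) ζ t, kappa (rawMoment QH Yhalf) ζ s; P] =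
        ∫ ω, bivariateNormalDensity t s (Y ω) ∂QY) ∧
    -- convergence of the finite-dimensional distributions of the scaled level set sums
    (∀ I : Finset ℝ, TendstoInDistribution
      (fun (N : ℕ) (ω : Ω' N) => fun t : I =>
        1 / 2 * √((N : ℝ) / 2 ^ N) *
          levelSum (g N) ⌊(N : ℝ) / 2 + √(N : ℝ) / 2 * (t : ℝ)⌋₊ ω)
      atTop
      (fun ω => fun t : I => kappa (rawMoment QH Yhalf) ζ t ω) P' P) := by
  have hYm := hY.aemeasurable
  have hm2 := sq_rawMoment_half hν hY hYhalf
  have hmom : ∀ k, 0 ≤ rawMoment QY Y k := fun k => hm2 k ▸ sq_nonneg _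
  have hYlt := ae_abs_lt_one hYm hY.ae_abs_le_one
    (ae_lt_one_of_lintegral_lt_top hYm hY.ae_abs_le_one hfin) hmom
  have hint := integrable_inv_sqrt_one_sub_sq hYm hYlt hmom hfin
  set m := rawMoment QH Yhalf with hm
  have ha : ∀ t, Summable fun k => (m k * hermiteCoeff t k) ^ 2 :=
    summable_sq_mul_hermiteCoeff hYm hYlt hint hm2
  have hlim := fun t => ae_tendsto_kappa hζ_law hζ_ind (ha t)
  have hmehler := hasSum_rawMoment_mul_hermiteCoeff hYm hYlt hint
  have hcov : ∀ t s, cov[kappa m ζ t, kappa m ζ s; P]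
      = ∫ ω, bivariateNormalDensity t s (Y ω) ∂QY := fun t s => by
    rw [covariance_of_ae_tendsto_partialSum hζ_law hζ_ind (ha t) (ha s) (hlim t) (hlim s),
      ← (hmehler t s).tsum_eq]
    exact tsum_congr fun k => by rw [← hm2]; ring
  refine ⟨fun t => ?_, fun t => ⟨memLp_of_ae_tendsto_partialSum hζ_law hζ_ind (ha t) (hlim t), ?_⟩,
    isGaussianProcess_of_ae_tendsto_partialSum hζ_law hζ_ind ha hlim,
    fun t => integral_of_ae_tendsto_partialSum hζ_law hζ_ind (ha t) (hlim t),
    fun t s => ?_, hYlt,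
    fun t s => ⟨integrable_bivariateNormalDensity hYm hYlt hint t s, hcov t s⟩, fun I => ?_⟩
  · simpa only [kappaPartial_eq] using hlim t
  · simpa only [kappaPartial_eq] using
      tendsto_eLpNorm_partialSum_sub hζ_law hζ_ind (ha t) (hlim t)
  · set c := 1 / (2 * Real.pi) * Real.exp (-(t ^ 2 + s ^ 2) / 2) with hc
    have hc0 : c ≠ 0 := by positivity
    have h := hmehler t s
    simp_rw [hermiteCoeff_mul, ← hc] at h
    have h' : HasSum (fun k => rawMoment QY Y k * (1 / (k.factorial : ℝ)) * hermiteH k t *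
        hermiteH k s) (c⁻¹ * ∫ ω, bivariateNormalDensity t s (Y ω) ∂QY) := by
      refine (h.mul_left c⁻¹).congr_fun fun k => ?_
      rw [mul_left_comm, inv_mul_cancel_left₀ hc0]
      ring
    refine ⟨(summable_nat_add_iff 1).2 h'.summable, ?_⟩
    have h0 : rawMoment QY Y 0 * (1 / (Nat.factorial 0 : ℝ)) * hermiteH 0 t * hermiteH 0 s = 1 := by
      simp [rawMoment, hermiteH]
    have h1 := h'.summable.tsum_eq_zero_add
    rw [h'.tsum_eq, h0] at h1
    rw [hcov, ← h1, mul_inv_cancel_left₀ hc0]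
  · refine tendstoInDistribution_levelSum hζ_law hζ_ind hζ'_law hζ'_ind hg
      (fun (N : ℕ) (t : I) => ⌊(N : ℝ) / 2 + √(N : ℝ) / 2 * (t : ℝ)⌋₊)
      (fun t => aemeasurable_of_ae_tendsto_partialSum hζ_law (hlim t)) fun t => ?_
    exact tendsto_eLpNorm_levelMap_sub_kappa hYm hYlt hint hm2 hζ_law hζ_ind t (t : ℝ) fun k =>
      tendsto_levelCoeff (eventually_floor_le t) (tendsto_floor t) k
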